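/- All algebras are (not necessarily unital) associative complex algebras and all homomorphisms are linear; for subsets $X,Y$ of an algebra or module, $XY$ denotes the linear span of the products. For a non-degenerate algebra $A$ (that is, $aA=0$ or $Aa=0$ implies $a=0$), $M(A)$ denotes its multiplier algebra. \textbf{Multiplier bialgebroids.} A multiplier bialgebroid $\mathcal A=(A,B,C,t_B,t_C,\Delta_B,\Delta_C)$ consists of a non-degenerate algebra $A$ with $AA=A$, commuting subalgebras $B,C\subseteq M(A)$ such that the modules ${}_BA,A_B,{}_CA,A_C$ are non-degenerate and idempotent, anti-isomorphisms $t_B\colon B\to C$ and $t_C\colon C\to B$, and comultiplications $\Delta_B,\Delta_C$ as follows. Let $A^C\otimes{}_CA$ be the quotient of $A\otimes A$ by the relations $t_C(y)a\otimes b=a\otimes yb$ ($y\in C$), and $A_B\otimes{}^BA$ the quotient by the relations $ax\otimes b=a\otimes bt_B(x)$ ($x\in B$). The first is assumed non-degenerate as a right module over $A\otimes1$ and over $1\otimes A$, the second as a left module over $A\otimes 1$ and over $1\otimes A$. The maps $\Delta_C\colon A\to\operatorname{End}(A^C\otimes{}_CA)$ and $\Delta_B\colon A\to\operatorname{End}(A_B\otimes{}^BA)^{\mathrm{op}}$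 (with $\Delta_B(a)$ acting from the right) are homomorphisms such that for all $a,b,c\in A$, $x,x'\in B$, $y,y'\in C$: (i) there are elements $\Delta_C(c)(a\otimes1),\Delta_C(c)(1\otimes b)\in A^C\otimes{}_CA$ and $(a\otimes1)\Delta_B(c),(1\otimes b)\Delta_B(c)\in A_B\otimes{}^BA$ (depending only on $a,c$ or on $b,c$, respectively) with $\Delta_C(c)(a\otimes b)=(\Delta_C(c)(a\otimes1))(1\otimes b)=(\Delta_C(c)(1\otimes b))(a\otimes1)$ and $(a\otimes b)\Delta_B(c)=(1\otimes b)((a\otimes1)\Delta_B(c))=(a\otimes1)((1\otimes b)\Delta_B(c))$; (ii) $\Delta_C(xyax'y')=(y\otimes x)\Delta_C(a)(y'\otimes x')$ and $\Delta_B(xyax'y')=(y\otimes x)\Delta_B(a)(y'\otimes x')$; (iii) in the respective threefold balanced tensor products, $$(\Delta_C\otimes\iota)(\Delta_C(b)(1\otimes c))(a\otimes1\otimes1)=(\iota\otimes\Delta_C)(\Delta_C(b)(a\otimes1))(1\otimes1\otimes c),$$ $$(a\otimes1\otimes1)(\Delta_B\otimes\iota)((1\otimes c)\Delta_B(b))=(1\otimes1\otimes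 c)(\iota\otimes\Delta_B)((a\otimes1)\Delta_B(b)),$$ $$(\Delta_C\otimes\iota)((1\otimes c)\Delta_B(b))(a\otimes1\otimes1)=(1\otimes1\otimes c)(\iota\otimes\Delta_B)(\Delta_C(b)(a\otimes1)),$$ $$(a\otimes1\otimes1)(\Delta_B\otimes\iota)(\Delta_C(b)(1\otimes c))=(\iota\otimes\Delta_C)((a\otimes1)\Delta_B(b))(1\otimes1\otimes c).$$ \textbf{Regular multiplier Hopf algebroids.} $\mathcal A$ is a regular multiplier Hopf algebroid with antipode $S$ if there are linear maps ${}_C\varepsilon\colon A\to C$ and $\varepsilon_B\colon A\to B$ with ${}_C\varepsilon(ya)=y\,{}_C\varepsilon(a)$, ${}_C\varepsilon(t_C(y)a)={}_C\varepsilon(a)y$, $\varepsilon_B(at_B(x))=x\varepsilon_B(a)$, $\varepsilon_B(ax)=\varepsilon_B(a)x$ and $$({}_C\varepsilon\odot\iota)(\Delta_C(a)(1\otimes b))=ab=(\iota\odot{}_C\varepsilon)(\Delta_C(a)(b\otimes1)),\quad(\varepsilon_B\odot\iota)((1\otimes b)\Delta_B(a))=ba=(\iota\odot\varepsilon_B)((b\otimes1)\Delta_B(a)),$$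 where $({}_C\varepsilon\odot\iota)(p\otimes q)={}_C\varepsilon(p)q$, $(\iota\odot{}_C\varepsilon)(p\otimes q)=t_C({}_C\varepsilon(q))p$, $(\varepsilon_B\odot\iota)(p\otimes q)=q\,t_B(\varepsilon_B(p))$, $(\iota\odot\varepsilon_B)(p\otimes q)=p\,\varepsilon_B(q)$, and $S$ is an anti-automorphism of $A$ whose extension to $M(A)$ satisfies $S|_B=t_C^{-1}$, $S|_C=t_B^{-1}$ and, with $m$ denoting multiplication, $$m(S\otimes\iota)(\Delta_C(a)(1\otimes b))=\varepsilon_B(a)b,\qquad m(\iota\otimes S)((a\otimes1)\Delta_B(b))=a\,{}_C\varepsilon(b).$$ \textbf{Morphisms.} Let $\mathcal A=(A,B,C,t_B,t_C,\Delta_B,\Delta_C)$ and $\mathcal D=(D,E,F,t_E,t_F,\Delta_E,\Delta_F)$ be regular multiplier Hopf algebroids. A morphism from $\mathcal D$ to $\mathcal A$ is a homomorphism $\pi\colon D\to M(A)$ that is non-degenerate, i.e. $\pi(D)A=A=A\pi(D)$, and whose extension to $M(D)$ satisfies $$\pi(E)B=B=B\pi(E),\quad\pi\circ t_E=t_B\circ\pi\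 \text{on }E,\qquad\pi(F)C=C=C\pi(F),\quad\pi\circ t_F=t_C\circ\pi\ \text{on }F$$ (with $t_B,t_C$ extended to anti-isomorphisms between $M(B)$ and $M(C)$), and $$(a'\pi(d')\otimes a''\pi(d''))\Delta_B(\pi(d))=(a'\otimes a'')(\pi\otimes\pi)((d'\otimes d'')\Delta_E(d)),$$ $$\Delta_C(\pi(d))(\pi(d')a'\otimes\pi(d'')a'')=(\pi\otimes\pi)(\Delta_F(d)(d'\otimes d''))(a'\otimes a'')$$ for all $a',a''\in A$ and $d,d',d''\in D$, where $\Delta_B$ and $\Delta_C$ are extended to $M(A)$ by $(a\otimes b)\Delta_B(c)\Delta_B(T)=(a\otimes b)\Delta_B(cT)$ and $\Delta_C(T)\Delta_C(c)(a\otimes b)=\Delta_C(Tc)(a\otimes b)$ for $T\in M(A)$, $a,b,c\in A$. \textbf{Theorem.} Let $\mathcal A$ and $\mathcal D$ be regular multiplier Hopf algebroids with antipodes $S_A$ and $S_D$, respectively, and let $\pi\colon D\to M(A)$ be a morphism from $\mathcal D$ to $\mathcal A$. Then $\pi\circ S_D=S_A\circ\pi$, where $S_A$ is extended to $M(A)$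 by $S_A(T)S_A(a)=S_A(aT)$ and $S_A(a)S_A(T)=S_A(Ta)$. -/

import Mathlib

open scoped TensorProduct

noncomputable section

namespace MultHopf

section Algebra

variable (A : Type*) [NonUnitalRing A] [Module ℂ A] [IsScalarTower ℂ A A] [SMulCommClass ℂ A A]

/-- `A` is non-degenerate: `a A = 0` or `A a = 0` implies `a = 0`. -/
structure IsNondegenerateAlg : Prop where
  left : ∀ a : A, (∀ b : A, a * b = 0) → a = 0
  right : ∀ a : A, (∀ b : A, b * a = 0) → a = 0

/-- `A` is idempotent: `A A = A`, where `A A` denotes the linear span of all products. -/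
def IsIdempotentAlg : Prop :=
  Submodule.span ℂ {c : A | ∃ a b : A, c = a * b} = ⊤

/-- The multiplier algebra of `A`: pairs of linear maps `(a ↦ T a, a ↦ a T)` with
`T (a b) = (T a) b`, `(a b) T = a (b T)` and `(a T) b = a (T b)`.
(The first two identities are automatic if `A` is non-degenerate.) -/
def multiplierAlgebra : Subalgebra ℂ (Module.End ℂ A × (Module.End ℂ A)ᵐᵒᵖ) where
  carrier := {T | (∀ a b : A, T.1 (a * b) = T.1 a * b) ∧
    (∀ a b : A, T.2.unop (a * b) = a * T.2.unop b) ∧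
    (∀ a b : A, T.2.unop a * b = a * T.1 b)}
  mul_mem' := by
    rintro S T ⟨h1, h2, h3⟩ ⟨k1, k2, k3⟩
    refine ⟨fun a b => ?_, fun a b => ?_, fun a b => ?_⟩
    · simp [k1, h1]
    · simp [k2, h2]
    · simp [k3, h3]
  add_mem' := by
    rintro S T ⟨h1, h2, h3⟩ ⟨k1, k2, k3⟩
    refine ⟨fun a b => ?_, fun a b => ?_, fun a b => ?_⟩
    · simp [k1, h1, add_mul]
    · simp [k2, h2, mul_add]
    · simp [k3, h3, add_mul, mul_add]
  algebraMap_mem' := by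
    intro r
    refine ⟨fun a b => ?_, fun a b => ?_, fun a b => ?_⟩ <;>
      simp [Algebra.algebraMap_eq_smul_one, smul_mul_assoc, mul_smul_comm]

/-- The type of multipliers of `A`. -/
abbrev Multiplier : Type _ := multiplierAlgebra A

end Algebra

section Basic

variable {A : Type*} [NonUnitalRing A] [Module ℂ A] [IsScalarTower ℂ A A] [SMulCommClass ℂ A A]

/-- The map `a ↦ T a`. -/
def lact (T : Multiplier A) : A →ₗ[ℂ] A := T.1.1

/-- The map `a ↦ a T`. -/
def ract (T : Multiplier A) : A →ₗ[ℂ] A := T.1.2.unop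

theorem lact_mul' (T : Multiplier A) (a b : A) : lact T (a * b) = lact T a * b := T.2.1 a b

theorem ract_mul' (T : Multiplier A) (a b : A) : ract T (a * b) = a * ract T b := T.2.2.1 a b

theorem ract_mul_eq (T : Multiplier A) (a b : A) : ract T a * b = a * lact T b := T.2.2.2 a b

theorem lact_mul (S T : Multiplier A) (a : A) : lact (S * T) a = lact S (lact T a) := rfl

theorem ract_mul (S T : Multiplier A) (a : A) : ract (S * T) a = ract T (ract S a) := rfl

/-- The multiplier with prescribed left and right action. -/
def mkMultiplier (L R : A →ₗ[ℂ] A) (h1 : ∀ a b, L (a * b) = L a * b)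
    (h2 : ∀ a b, R (a * b) = a * R b) (h3 : ∀ a b, R a * b = a * L b) : Multiplier A :=
  ⟨(L, MulOpposite.op R), h1, h2, h3⟩

/-- The extension of an anti-automorphism `S` of `A` to multipliers, determined by
`S(T) S(a) = S(a T)` and `S(a) S(T) = S(T a)`. -/
def antiExtend (S : A ≃ₗ[ℂ] A) (hS : ∀ a b, S (a * b) = S b * S a) (T : Multiplier A) :
    Multiplier A :=
  mkMultiplier (S.toLinearMap ∘ₗ ract T ∘ₗ S.symm.toLinearMap)
    (S.toLinearMap ∘ₗ lact T ∘ₗ S.symm.toLinearMap)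
    (by
      intro a b
      obtain ⟨a, rfl⟩ := S.surjective a
      obtain ⟨b, rfl⟩ := S.surjective b
      simp [← hS, ract_mul'])
    (by
      intro a b
      obtain ⟨a, rfl⟩ := S.surjective a
      obtain ⟨b, rfl⟩ := S.surjective b
      simp [← hS, lact_mul'])
    (by
      intro a b
      obtain ⟨a, rfl⟩ := S.surjective a
      obtain ⟨b, rfl⟩ := S.surjective b
      simp [← hS, ract_mul_eq])

/-! Balanced tensor products over possibly non-unital algebras. -/

/-- The relations `a · i ⊗ b = a ⊗ i · b`, where `f` describes the right action on the first
factor and `g` the left action on the second one. -/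
def balRel {ι : Type*} (f g : ι → A →ₗ[ℂ] A) : Submodule ℂ (A ⊗[ℂ] A) :=
  Submodule.span ℂ {z | ∃ i a b, z = f i a ⊗ₜ[ℂ] b - a ⊗ₜ[ℂ] g i b}

/-- The balanced tensor product of `A` with itself, with actions described by `f` and `g`. -/
abbrev Bal {ι : Type*} (f g : ι → A →ₗ[ℂ] A) : Type _ := (A ⊗[ℂ] A) ⧸ balRel f g

/-- The class of `a ⊗ b` in the balanced tensor product. -/
def Bal.tmul {ι : Type*} (f g : ι → A →ₗ[ℂ] A) : A →ₗ[ℂ] A →ₗ[ℂ] Bal f g :=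
  (TensorProduct.mk ℂ A A).compr₂ (balRel f g).mkQ

/-- The map `φ ⊗ ψ` on a balanced tensor product, for module maps `φ` and `ψ`. -/
def Bal.map {ι : Type*} {f g : ι → A →ₗ[ℂ] A} (φ ψ : A →ₗ[ℂ] A)
    (hφ : ∀ i a, φ (f i a) = f i (φ a)) (hψ : ∀ i a, ψ (g i a) = g i (ψ a)) :
    Bal f g →ₗ[ℂ] Bal f g :=
  Submodule.mapQ _ _ (TensorProduct.map φ ψ) (by
    refine Submodule.span_le.2 ?_
    rintro _ ⟨i, a, b, rfl⟩
    refine Submodule.subset_span ⟨i, φ a, ψ b, ?_⟩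
    simp [hφ, hψ])

/-- For a bilinear map `G` that is compatible with the balancing relations, this says that the
linear map `p ⊗ q ↦ G p q` on the balanced tensor product sends `z` to `r`. -/
def Bal.Sends {ι : Type*} {f g : ι → A →ₗ[ℂ] A} {Q : Type*} [AddCommGroup Q] [Module ℂ Q]
    (G : A →ₗ[ℂ] A →ₗ[ℂ] Q) (z : Bal f g) (r : Q) : Prop :=
  ∀ u : A ⊗[ℂ] A, (balRel f g).mkQ u = z → TensorProduct.lift G u = r

/-- The relations of a threefold balanced tensor product; `f`, `g` describe the actions between
the first and second factor and `h`, `k` those between the second and third. -/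
def tripRel {ι κ : Type*} (f g : ι → A →ₗ[ℂ] A) (h k : κ → A →ₗ[ℂ] A) :
    Submodule ℂ (A ⊗[ℂ] (A ⊗[ℂ] A)) :=
  Submodule.span ℂ {z | ∃ i a b c, z = f i a ⊗ₜ[ℂ] (b ⊗ₜ[ℂ] c) - a ⊗ₜ[ℂ] (g i b ⊗ₜ[ℂ] c)} ⊔
  Submodule.span ℂ {z | ∃ j a b c, z = a ⊗ₜ[ℂ] (h j b ⊗ₜ[ℂ] c) - a ⊗ₜ[ℂ] (b ⊗ₜ[ℂ] k j c)}

/-- The threefold balanced tensor product. -/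
abbrev Trip {ι κ : Type*} (f g : ι → A →ₗ[ℂ] A) (h k : κ → A →ₗ[ℂ] A) : Type _ :=
  (A ⊗[ℂ] (A ⊗[ℂ] A)) ⧸ tripRel f g h k

/-- The canonical map `((a ⊗ b), c) ↦ a ⊗ b ⊗ c`. -/
def ins12 {ι κ : Type*} (f g : ι → A →ₗ[ℂ] A) (h k : κ → A →ₗ[ℂ] A) :
    Bal f g →ₗ[ℂ] A →ₗ[ℂ] Trip f g h k :=
  Submodule.liftQ _
    (TensorProduct.curry
      ((tripRel f g h k).mkQ ∘ₗ (TensorProduct.assoc ℂ A A A).toLinearMap))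
    (by
      refine Submodule.span_le.2 ?_
      rintro _ ⟨i, a, b, rfl⟩
      simp only [SetLike.mem_coe, LinearMap.mem_ker]
      ext c
      simp only [TensorProduct.curry_apply, map_sub, LinearMap.sub_apply, LinearMap.comp_apply,
        LinearEquiv.coe_coe, TensorProduct.assoc_tmul, LinearMap.zero_apply]
      rw [← map_sub, Submodule.mkQ_apply, Submodule.Quotient.mk_eq_zero]
      exact Submodule.mem_sup_left (Submodule.subset_span ⟨i, a, b, c, rfl⟩))

/-- The canonical map `(a, (b ⊗ c)) ↦ a ⊗ b ⊗ c`. -/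
def ins23 {ι κ : Type*} (f g : ι → A →ₗ[ℂ] A) (h k : κ → A →ₗ[ℂ] A) :
    A →ₗ[ℂ] Bal h k →ₗ[ℂ] Trip f g h k :=
  (Submodule.liftQ (balRel h k)
    ((TensorProduct.mk ℂ A (A ⊗[ℂ] A)).compr₂ (tripRel f g h k).mkQ).flip
    (by
      refine Submodule.span_le.2 ?_
      rintro _ ⟨i, b, c, rfl⟩
      simp only [SetLike.mem_coe, LinearMap.mem_ker]
      ext a
      simp only [LinearMap.flip_apply, LinearMap.compr₂_apply, TensorProduct.mk_apply,
        TensorProduct.tmul_sub, LinearMap.zero_apply]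
      rw [Submodule.mkQ_apply, Submodule.Quotient.mk_eq_zero]
      exact Submodule.mem_sup_right (Submodule.subset_span ⟨i, a, b, c, rfl⟩))).flip

end Basic

section Solve

variable {A : Type*} [NonUnitalRing A] [Module ℂ A] {Q : Type*} [AddCommGroup Q] [Module ℂ Q]

/-- If for all `a, b` there is an element `u` with `u · c = F a b c` for all `c`, if such elements
are unique and `F` is bilinear in `a, b`, this is the bilinear map `(a, b) ↦ u`. -/
def solve (act : A → Q →ₗ[ℂ] Q)
    (nd : ∀ u, (∀ c, act c u = 0) → u = 0) (F : A →ₗ[ℂ] A →ₗ[ℂ] A → Q)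
    (hF : ∀ a b, ∃ u, ∀ c, act c u = F a b c) : A →ₗ[ℂ] A →ₗ[ℂ] Q :=
  have ext : ∀ u v, (∀ c, act c u = act c v) → u = v := fun u v h =>
    sub_eq_zero.1 (nd _ fun c => by rw [map_sub, h, sub_self])
  have sp : ∀ a b c, act c (hF a b).choose = F a b c := fun a b => (hF a b).choose_spec
  LinearMap.mk₂ ℂ (fun a b => (hF a b).choose)
    (fun a a' b => ext _ _ fun c => by
      refine (sp _ _ c).trans (Eq.trans ?_ ((map_add (act c) _ _).trans (congrArg₂ _ (sp _ _ c) (sp _ _ c))).symm)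
      rw [map_add]; rfl)
    (fun r a b => ext _ _ fun c => by
      refine (sp _ _ c).trans (Eq.trans ?_ ((map_smul (act c) _ _).trans (congrArg _ (sp _ _ c))).symm)
      rw [map_smul]; rfl)
    (fun a b b' => ext _ _ fun c => by
      refine (sp _ _ c).trans (Eq.trans ?_ ((map_add (act c) _ _).trans (congrArg₂ _ (sp _ _ c) (sp _ _ c))).symm)
      rw [map_add]; rfl)
    (fun r a b => ext _ _ fun c => by
      refine (sp _ _ c).trans (Eq.trans ?_ ((map_smul (act c) _ _).trans (congrArg _ (sp _ _ c))).symm)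
      rw [map_smul]; rfl)

theorem solve_spec (act : A → Q →ₗ[ℂ] Q)
    (nd : ∀ u, (∀ c, act c u = 0) → u = 0) (F : A →ₗ[ℂ] A →ₗ[ℂ] A → Q)
    (hF : ∀ a b, ∃ u, ∀ c, act c u = F a b c) (a b c : A) :
    act c (solve act nd F hF a b) = F a b c :=
  (hF a b).choose_spec c

end Solve

/-- The total algebra `A` and the base algebras `B, C ⊆ M(A)` with anti-isomorphisms
`tB : B → C`, `tC : C → B`. All (left and right) module structures are required to be
non-degenerate and idempotent. -/
structure BaseData (A : Type*) [NonUnitalRing A] [Module ℂ A] [IsScalarTower ℂ A A]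
    [SMulCommClass ℂ A A] where
  nondegenerate : IsNondegenerateAlg A
  idempotent : IsIdempotentAlg A
  B : NonUnitalSubalgebra ℂ (Multiplier A)
  C : NonUnitalSubalgebra ℂ (Multiplier A)
  tB : B ≃ₗ[ℂ] C
  tB_mul : ∀ x x' : B, tB (x * x') = tB x' * tB x
  tC : C ≃ₗ[ℂ] B
  tC_mul : ∀ y y' : C, tC (y * y') = tC y' * tC y
  comm : ∀ (x : B) (y : C), (x : Multiplier A) * (y : Multiplier A) = y * x
  nondeg_BA : ∀ a : A, (∀ x : B, lact x.1 a = 0) → a = 0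
  nondeg_AB : ∀ a : A, (∀ x : B, ract x.1 a = 0) → a = 0
  nondeg_CA : ∀ a : A, (∀ y : C, lact y.1 a = 0) → a = 0
  nondeg_AC : ∀ a : A, (∀ y : C, ract y.1 a = 0) → a = 0
  idem_BA : Submodule.span ℂ {c : A | ∃ (x : B) (a : A), c = lact x.1 a} = ⊤
  idem_AB : Submodule.span ℂ {c : A | ∃ (x : B) (a : A), c = ract x.1 a} = ⊤
  idem_CA : Submodule.span ℂ {c : A | ∃ (y : C) (a : A), c = lact y.1 a} = ⊤
  idem_AC : Submodule.span ℂ {c : A | ∃ (y : C) (a : A), c = ract y.1 a} = ⊤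

namespace BaseData

variable {A : Type*} [NonUnitalRing A] [Module ℂ A] [IsScalarTower ℂ A A] [SMulCommClass ℂ A A]
  (𝒜 : BaseData A)

/-- The right action `a · y = tC(y) a` of `C`. -/
def actCr (y : 𝒜.C) : A →ₗ[ℂ] A := lact (𝒜.tC y).1

/-- The left action `y · a = y a` of `C`. -/
def actCl (y : 𝒜.C) : A →ₗ[ℂ] A := lact y.1

/-- The right action `a · x = a x` of `B`. -/
def actBr (x : 𝒜.B) : A →ₗ[ℂ] A := ract x.1

/-- The left action `x · a = a tB(x)` of `B`. -/
def actBl (x : 𝒜.B) : A →ₗ[ℂ] A := ract (𝒜.tB x).1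

/-- The balanced tensor product `A^C ⊗ _C A`, where `tC(y) a ⊗ b = a ⊗ y b`. -/
abbrev TC : Type _ := Bal 𝒜.actCr 𝒜.actCl

/-- The balanced tensor product `A_B ⊗ ^B A`, where `a x ⊗ b = a ⊗ b tB(x)`. -/
abbrev TB : Type _ := Bal 𝒜.actBr 𝒜.actBl

/-- The class of `a ⊗ b` in `A^C ⊗ _C A`. -/
def tc : A →ₗ[ℂ] A →ₗ[ℂ] 𝒜.TC := Bal.tmul _ _

/-- The class of `a ⊗ b` in `A_B ⊗ ^B A`. -/
def tb : A →ₗ[ℂ] A →ₗ[ℂ] 𝒜.TB := Bal.tmul _ _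

/-- The map `u ↦ u (a ⊗ 1)` on `A^C ⊗ _C A`. -/
def tcMul1 (a : A) : 𝒜.TC →ₗ[ℂ] 𝒜.TC :=
  Bal.map (LinearMap.mulRight ℂ a) LinearMap.id
    (fun y p => by simp [actCr, lact_mul']) (fun _ _ => rfl)

/-- The map `u ↦ u (1 ⊗ a)` on `A^C ⊗ _C A`. -/
def tcMul2 (a : A) : 𝒜.TC →ₗ[ℂ] 𝒜.TC :=
  Bal.map LinearMap.id (LinearMap.mulRight ℂ a)
    (fun _ _ => rfl) (fun y p => by simp [actCl, lact_mul'])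

/-- The map `u ↦ (a ⊗ 1) u` on `A_B ⊗ ^B A`. -/
def tbMul1 (a : A) : 𝒜.TB →ₗ[ℂ] 𝒜.TB :=
  Bal.map (LinearMap.mulLeft ℂ a) LinearMap.id
    (fun y p => by simp [actBr, ract_mul']) (fun _ _ => rfl)

/-- The map `u ↦ (1 ⊗ a) u` on `A_B ⊗ ^B A`. -/
def tbMul2 (a : A) : 𝒜.TB →ₗ[ℂ] 𝒜.TB :=
  Bal.map LinearMap.id (LinearMap.mulLeft ℂ a)
    (fun _ _ => rfl) (fun y p => by simp [actBl, ract_mul'])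

/-- The map `u ↦ (y ⊗ x) u` on `A^C ⊗ _C A`. -/
def tcBase (y : 𝒜.C) (x : 𝒜.B) : 𝒜.TC →ₗ[ℂ] 𝒜.TC :=
  Bal.map (lact y.1) (lact x.1)
    (fun y' p => by rw [actCr, ← lact_mul, ← lact_mul, 𝒜.comm])
    (fun y' p => by rw [actCl, ← lact_mul, ← lact_mul, 𝒜.comm])

/-- The map `u ↦ u (y ⊗ x)` on `A_B ⊗ ^B A`. -/
def tbBase (y : 𝒜.C) (x : 𝒜.B) : 𝒜.TB →ₗ[ℂ] 𝒜.TB :=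
  Bal.map (ract y.1) (ract x.1)
    (fun y' p => by rw [actBr, ← ract_mul, ← ract_mul, 𝒜.comm])
    (fun y' p => by rw [actBl, ← ract_mul, ← ract_mul, 𝒜.comm])

/-- The extended left Takeuchi product inside `End(A^C ⊗ _C A)`: for all `a, b` there are elements
`W (a ⊗ 1)` and `W (1 ⊗ b)` with `W (a ⊗ b) = (W (a ⊗ 1)) (1 ⊗ b) = (W (1 ⊗ b)) (a ⊗ 1)`. -/
def IsTakeuchiC (W : Module.End ℂ 𝒜.TC) : Prop :=
  (∀ a, ∃ u, ∀ b, 𝒜.tcMul2 b u = W (𝒜.tc a b)) ∧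
  (∀ b, ∃ u, ∀ a, 𝒜.tcMul1 a u = W (𝒜.tc a b))

/-- The extended right Takeuchi product inside `End(A_B ⊗ ^B A)`; here `W` is the map
`u ↦ u W`, and there are elements `(a ⊗ 1) W` and `(1 ⊗ b) W` with
`(a ⊗ b) W = (1 ⊗ b) ((a ⊗ 1) W) = (a ⊗ 1) ((1 ⊗ b) W)`. -/
def IsTakeuchiB (W : Module.End ℂ 𝒜.TB) : Prop :=
  (∀ a, ∃ u, ∀ b, 𝒜.tbMul2 b u = W (𝒜.tb a b)) ∧
  (∀ b, ∃ u, ∀ a, 𝒜.tbMul1 a u = W (𝒜.tb a b))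

end BaseData

/-- The ingredients of a multiplier bialgebroid, with all conditions except co-associativity. -/
structure PreBialgebroid (A : Type*) [NonUnitalRing A] [Module ℂ A] [IsScalarTower ℂ A A]
    [SMulCommClass ℂ A A] extends BaseData A where
  nondeg_TC1 : ∀ u : toBaseData.TC, (∀ a, toBaseData.tcMul1 a u = 0) → u = 0
  nondeg_TC2 : ∀ u : toBaseData.TC, (∀ a, toBaseData.tcMul2 a u = 0) → u = 0
  nondeg_TB1 : ∀ u : toBaseData.TB, (∀ a, toBaseData.tbMul1 a u = 0) → u = 0
  nondeg_TB2 : ∀ u : toBaseData.TB, (∀ a, toBaseData.tbMul2 a u = 0) → u = 0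
  /-- The left comultiplication `Δ_C`. -/
  ΔC : A →ₙₐ[ℂ] Module.End ℂ toBaseData.TC
  ΔC_mem : ∀ a, toBaseData.IsTakeuchiC (ΔC a)
  /-- The right comultiplication `Δ_B`; `(ΔB a).unop` is the map `u ↦ u Δ_B(a)`. -/
  ΔB : A →ₙₐ[ℂ] (Module.End ℂ toBaseData.TB)ᵐᵒᵖ
  ΔB_mem : ∀ a, toBaseData.IsTakeuchiB (ΔB a).unop
  /-- `Δ_C(x y a x' y') = (y ⊗ x) Δ_C(a) (y' ⊗ x')`. -/
  ΔC_bilinear : ∀ (x x' : B) (y y' : C) (a : A) (u : toBaseData.TC),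
    ΔC (ract y'.1 (ract x'.1 (lact x.1 (lact y.1 a)))) u =
      toBaseData.tcBase y x (ΔC a (toBaseData.tcBase y' x' u))
  /-- `Δ_B(x y a x' y') = (y ⊗ x) Δ_B(a) (y' ⊗ x')`. -/
  ΔB_bilinear : ∀ (x x' : B) (y y' : C) (a : A) (u : toBaseData.TB),
    (ΔB (ract y'.1 (ract x'.1 (lact x.1 (lact y.1 a))))).unop u =
      toBaseData.tbBase y' x' ((ΔB a).unop (toBaseData.tbBase y x u))

namespace PreBialgebroid

variable {A : Type*} [NonUnitalRing A] [Module ℂ A] [IsScalarTower ℂ A A] [SMulCommClass ℂ A A]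
  (𝒜 : PreBialgebroid A)

/-- The map `(a, b) ↦ Δ_C(b)(a ⊗ 1)`. -/
def Tlam : A →ₗ[ℂ] A →ₗ[ℂ] 𝒜.TC :=
  solve 𝒜.tcMul2 𝒜.nondeg_TC2
    (LinearMap.mk₂ ℂ (fun a b c => 𝒜.ΔC b (𝒜.tc a c))
      (by intros; ext; simp) (by intros; ext; simp) (by intros; ext; simp) (by intros; ext; simp))
    (fun a b => (𝒜.ΔC_mem b).1 a)

/-- The map `(a, b) ↦ Δ_C(a)(1 ⊗ b)`. -/
def Trho : A →ₗ[ℂ] A →ₗ[ℂ] 𝒜.TC :=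
  solve 𝒜.tcMul1 𝒜.nondeg_TC1
    (LinearMap.mk₂ ℂ (fun a b c => 𝒜.ΔC a (𝒜.tc c b))
      (by intros; ext; simp) (by intros; ext; simp) (by intros; ext; simp) (by intros; ext; simp))
    (fun a b => (𝒜.ΔC_mem a).2 b)

/-- The map `(a, b) ↦ (a ⊗ 1)Δ_B(b)`. -/
def lamT : A →ₗ[ℂ] A →ₗ[ℂ] 𝒜.TB :=
  solve 𝒜.tbMul2 𝒜.nondeg_TB2
    (LinearMap.mk₂ ℂ (fun a b c => (𝒜.ΔB b).unop (𝒜.tb a c))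
      (by intros; ext; simp) (by intros; ext; simp) (by intros; ext; simp) (by intros; ext; simp))
    (fun a b => (𝒜.ΔB_mem b).1 a)

/-- The map `(a, b) ↦ (1 ⊗ b)Δ_B(a)`. -/
def rhoT : A →ₗ[ℂ] A →ₗ[ℂ] 𝒜.TB :=
  solve 𝒜.tbMul1 𝒜.nondeg_TB1
    (LinearMap.mk₂ ℂ (fun a b c => (𝒜.ΔB a).unop (𝒜.tb c b))
      (by intros; ext; simp) (by intros; ext; simp) (by intros; ext; simp) (by intros; ext; simp))
    (fun a b => (𝒜.ΔB_mem a).2 b)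

theorem Tlam_spec (a b c : A) : 𝒜.tcMul2 c (𝒜.Tlam a b) = 𝒜.ΔC b (𝒜.tc a c) :=
  solve_spec _ _ _ _ a b c

theorem Trho_spec (a b c : A) : 𝒜.tcMul1 c (𝒜.Trho a b) = 𝒜.ΔC a (𝒜.tc c b) :=
  solve_spec _ _ _ _ a b c

theorem lamT_spec (a b c : A) : 𝒜.tbMul2 c (𝒜.lamT a b) = (𝒜.ΔB b).unop (𝒜.tb a c) :=
  solve_spec _ _ _ _ a b c

theorem rhoT_spec (a b c : A) : 𝒜.tbMul1 c (𝒜.rhoT a b) = (𝒜.ΔB a).unop (𝒜.tb c b) :=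
  solve_spec _ _ _ _ a b c

end PreBialgebroid

open PreBialgebroid in
/-- A multiplier bialgebroid. In each co-associativity condition, both sides are the images of
elements of `A^C ⊗ _C A` or `A_B ⊗ ^B A` under linear maps of the form
`p ⊗ q ↦ (Δ(p)(a ⊗ 1)) ⊗ q` etc., which are compatible with the balancing relations by bilinearity
of the comultiplications. -/
structure MultiplierBialgebroid (A : Type*) [NonUnitalRing A] [Module ℂ A] [IsScalarTower ℂ A A]
    [SMulCommClass ℂ A A] extends PreBialgebroid A where
  /-- `(Δ_C ⊗ ι)(Δ_C(b)(1 ⊗ c)) (a ⊗ 1 ⊗ 1) = (ι ⊗ Δ_C)(Δ_C(b)(a ⊗ 1)) (1 ⊗ 1 ⊗ c)`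
  in `A^C ⊗ _C A^C ⊗ _C A`. -/
  coassoc_CC : ∀ a b c : A,
    ∃ r : Trip toBaseData.actCr toBaseData.actCl toBaseData.actCr toBaseData.actCl,
      Bal.Sends ((ins12 _ _ _ _) ∘ₗ toPreBialgebroid.Tlam a)
        (toPreBialgebroid.Trho b c) r ∧
      Bal.Sends ((ins23 _ _ _ _).compl₂ (toPreBialgebroid.Trho.flip c))
        (toPreBialgebroid.Tlam a b) r
  /-- `(a ⊗ 1 ⊗ 1) (Δ_B ⊗ ι)((1 ⊗ c)Δ_B(b)) = (1 ⊗ 1 ⊗ c) (ι ⊗ Δ_B)((a ⊗ 1)Δ_B(b))`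
  in `A_B ⊗ ^B A_B ⊗ ^B A`. -/
  coassoc_BB : ∀ a b c : A,
    ∃ r : Trip toBaseData.actBr toBaseData.actBl toBaseData.actBr toBaseData.actBl,
      Bal.Sends ((ins12 _ _ _ _) ∘ₗ toPreBialgebroid.lamT a)
        (toPreBialgebroid.rhoT b c) r ∧
      Bal.Sends ((ins23 _ _ _ _).compl₂ (toPreBialgebroid.rhoT.flip c))
        (toPreBialgebroid.lamT a b) r
  /-- `(Δ_C ⊗ ι)((1 ⊗ c)Δ_B(b)) (a ⊗ 1 ⊗ 1) = (1 ⊗ 1 ⊗ c) (ι ⊗ Δ_B)(Δ_C(b)(a ⊗ 1))`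
  in `A^C ⊗ _C A_B ⊗ ^B A`. -/
  coassoc_CB : ∀ a b c : A,
    ∃ r : Trip toBaseData.actCr toBaseData.actCl toBaseData.actBr toBaseData.actBl,
      Bal.Sends ((ins12 _ _ _ _) ∘ₗ toPreBialgebroid.Tlam a)
        (toPreBialgebroid.rhoT b c) r ∧
      Bal.Sends ((ins23 _ _ _ _).compl₂ (toPreBialgebroid.rhoT.flip c))
        (toPreBialgebroid.Tlam a b) r
  /-- `(a ⊗ 1 ⊗ 1) (Δ_B ⊗ ι)(Δ_C(b)(1 ⊗ c)) = (ι ⊗ Δ_C)((a ⊗ 1)Δ_B(b)) (1 ⊗ 1 ⊗ c)`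
  in `A_B ⊗ ^B A^C ⊗ _C A`. -/
  coassoc_BC : ∀ a b c : A,
    ∃ r : Trip toBaseData.actBr toBaseData.actBl toBaseData.actCr toBaseData.actCl,
      Bal.Sends ((ins12 _ _ _ _) ∘ₗ toPreBialgebroid.lamT a)
        (toPreBialgebroid.Trho b c) r ∧
      Bal.Sends ((ins23 _ _ _ _).compl₂ (toPreBialgebroid.Trho.flip c))
        (toPreBialgebroid.lamT a b) r

section Counits

variable {A : Type*} [NonUnitalRing A] [Module ℂ A] [IsScalarTower ℂ A A] [SMulCommClass ℂ A A]
  (𝒜 : MultiplierBialgebroid A)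

/-- The bilinear map `(T, a) ↦ T a`. -/
def lactHom : Multiplier A →ₗ[ℂ] A →ₗ[ℂ] A :=
  LinearMap.mk₂ ℂ (fun T a => lact T a) (fun _ _ _ => rfl) (fun _ _ _ => rfl)
    (fun _ a b => map_add _ a b) (fun r _ a => map_smul _ r a)

/-- The bilinear map `(T, a) ↦ a T`. -/
def ractHom : Multiplier A →ₗ[ℂ] A →ₗ[ℂ] A :=
  LinearMap.mk₂ ℂ (fun T a => ract T a) (fun _ _ _ => rfl) (fun _ _ _ => rfl)
    (fun _ a b => map_add _ a b) (fun r _ a => map_smul _ r a)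

/-- The inclusion of a subalgebra of `M(A)`. -/
def incl (B : NonUnitalSubalgebra ℂ (Multiplier A)) : B →ₗ[ℂ] Multiplier A :=
  ⟨⟨Subtype.val, fun _ _ => rfl⟩, fun _ _ => rfl⟩

/-- `ε : A → C` is a left counit. -/
structure IsLeftCounit (ε : A →ₗ[ℂ] 𝒜.C) : Prop where
  /-- `ε(y a) = y ε(a)`. -/
  map_left : ∀ (y : 𝒜.C) (a : A), ε (𝒜.actCl y a) = y * ε a
  /-- `ε(tC(y) a) = ε(a) y`. -/
  map_right : ∀ (y : 𝒜.C) (a : A), ε (𝒜.actCr y a) = ε a * y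
  /-- `(ε ⊙ ι)(Δ_C(a)(1 ⊗ b)) = a b`, where `(ε ⊙ ι)(p ⊗ q) = ε(p) q`. -/
  counit_rho : ∀ a b : A,
    Bal.Sends (lactHom ∘ₗ incl 𝒜.C ∘ₗ ε) (𝒜.Trho a b) (a * b)
  /-- `(ι ⊙ ε)(Δ_C(a)(b ⊗ 1)) = a b`, where `(ι ⊙ ε)(p ⊗ q) = tC(ε(q)) p`. -/
  counit_lam : ∀ a b : A,
    Bal.Sends (lactHom ∘ₗ incl 𝒜.B ∘ₗ 𝒜.tC.toLinearMap ∘ₗ ε).flip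
      (𝒜.Tlam b a) (a * b)

/-- `ε : A → B` is a right counit. -/
structure IsRightCounit (ε : A →ₗ[ℂ] 𝒜.B) : Prop where
  /-- `ε(a tB(x)) = x ε(a)`. -/
  map_left : ∀ (x : 𝒜.B) (a : A), ε (𝒜.actBl x a) = x * ε a
  /-- `ε(a x) = ε(a) x`. -/
  map_right : ∀ (x : 𝒜.B) (a : A), ε (𝒜.actBr x a) = ε a * x
  /-- `(ε ⊙ ι)((1 ⊗ b)Δ_B(a)) = b a`, where `(ε ⊙ ι)(p ⊗ q) = q tB(ε(p))`. -/
  counit_rho : ∀ a b : A,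
    Bal.Sends (ractHom ∘ₗ incl 𝒜.C ∘ₗ 𝒜.tB.toLinearMap ∘ₗ ε)
      (𝒜.rhoT a b) (b * a)
  /-- `(ι ⊙ ε)((b ⊗ 1)Δ_B(a)) = b a`, where `(ι ⊙ ε)(p ⊗ q) = p ε(q)`. -/
  counit_lam : ∀ a b : A,
    Bal.Sends (ractHom ∘ₗ incl 𝒜.B ∘ₗ ε).flip (𝒜.lamT b a) (b * a)

end Counits

/-- A regular multiplier Hopf algebroid: a multiplier bialgebroid with a left counit, a right
counit and an antipode (all of which are uniquely determined). -/
structure RegularMultiplierHopfAlgebroid (A : Type*) [NonUnitalRing A] [Module ℂ A]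
    [IsScalarTower ℂ A A] [SMulCommClass ℂ A A] extends MultiplierBialgebroid A where
  εC : A →ₗ[ℂ] C
  isLeftCounit : IsLeftCounit toMultiplierBialgebroid εC
  εB : A →ₗ[ℂ] B
  isRightCounit : IsRightCounit toMultiplierBialgebroid εB
  /-- The antipode. -/
  S : A ≃ₗ[ℂ] A
  S_mul : ∀ a b, S (a * b) = S b * S a
  /-- `S(x) = tC⁻¹(x)` for `x ∈ B`. -/
  S_B : ∀ x : B, antiExtend S S_mul x.1 = (tC.symm x).1
  /-- `S(y) = tB⁻¹(y)` for `y ∈ C`. -/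
  S_C : ∀ y : C, antiExtend S S_mul y.1 = (tB.symm y).1
  /-- `m (S ⊗ ι)(Δ_C(a)(1 ⊗ b)) = εB(a) b`. -/
  antipode_left : ∀ a b : A,
    Bal.Sends (LinearMap.mul ℂ A ∘ₗ S.toLinearMap)
      (toPreBialgebroid.Trho a b) (lact (εB a).1 b)
  /-- `m (ι ⊗ S)((a ⊗ 1)Δ_B(b)) = a εC(b)`. -/
  antipode_right : ∀ a b : A,
    Bal.Sends ((LinearMap.mul ℂ A).compl₂ S.toLinearMap)
      (toPreBialgebroid.lamT a b) (ract (εC b).1 a)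

section Morphisms

variable {D : Type*} [NonUnitalRing D] [Module ℂ D] [IsScalarTower ℂ D D] [SMulCommClass ℂ D D]
  {A : Type*} [NonUnitalRing A] [Module ℂ A] [IsScalarTower ℂ A A] [SMulCommClass ℂ A A]

/-- A homomorphism `π : D → M(A)` is non-degenerate if `π(D) A = A = A π(D)`. -/
structure IsNondegenerateHom (π : D →ₙₐ[ℂ] Multiplier A) : Prop where
  left : Submodule.span ℂ {c : A | ∃ (d : D) (a : A), c = lact (π d) a} = ⊤
  right : Submodule.span ℂ {c : A | ∃ (d : D) (a : A), c = ract (π d) a} = ⊤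

/-- A non-degenerate homomorphism `π : D → M(A)` extends uniquely to multipliers, such that
`π(T) π(d) a = π(T d) a` and `a π(d) π(T) = a π(d T)`. -/
theorem exists_unique_extension (hA : IsNondegenerateAlg A) (π : D →ₙₐ[ℂ] Multiplier A)
    (hπ : IsNondegenerateHom π) (T : Multiplier D) :
    ∃! W : Multiplier A,
      (∀ (d : D) (a : A), lact W (lact (π d) a) = lact (π (lact T d)) a) ∧
      (∀ (d : D) (a : A), ract W (ract (π d) a) = ract (π (ract T d)) a) := by
  have indL : ∀ (P : A → Prop), P 0 → (∀ a b, P a → P b → P (a + b)) →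
      (∀ (r : ℂ) a, P a → P (r • a)) → (∀ d a, P (lact (π d) a)) → ∀ a, P a := by
    intro P h0 hadd hsmul hg a
    have ha : a ∈ Submodule.span ℂ {c : A | ∃ (d : D) (a : A), c = lact (π d) a} := by
      rw [hπ.left]; trivial
    induction ha using Submodule.span_induction with
    | mem x hx => obtain ⟨d, b, rfl⟩ := hx; exact hg d b
    | zero => exact h0
    | add x y _ _ hx hy => exact hadd x y hx hy
    | smul r x _ hx => exact hsmul r x hx
  have indR : ∀ (P : A → Prop), P 0 → (∀ a b, P a → P b → P (a + b)) →
      (∀ (r : ℂ) a, P a → P (r • a)) → (∀ d a, P (ract (π d) a)) → ∀ a, P a := by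
    intro P h0 hadd hsmul hg a
    have ha : a ∈ Submodule.span ℂ {c : A | ∃ (d : D) (a : A), c = ract (π d) a} := by
      rw [hπ.right]; trivial
    induction ha using Submodule.span_induction with
    | mem x hx => obtain ⟨d, b, rfl⟩ := hx; exact hg d b
    | zero => exact h0
    | add x y _ _ hx hy => exact hadd x y hx hy
    | smul r x _ hx => exact hsmul r x hx
  let πl : D →ₗ[ℂ] Multiplier A := ⟨⟨π, map_add π⟩, map_smul π⟩
  let μ : D ⊗[ℂ] A →ₗ[ℂ] A := TensorProduct.lift (lactHom ∘ₗ πl)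
  let ν : D ⊗[ℂ] A →ₗ[ℂ] A := TensorProduct.lift (lactHom ∘ₗ πl ∘ₗ lact T)
  let μ' : D ⊗[ℂ] A →ₗ[ℂ] A := TensorProduct.lift (ractHom ∘ₗ πl)
  let ν' : D ⊗[ℂ] A →ₗ[ℂ] A := TensorProduct.lift (ractHom ∘ₗ πl ∘ₗ ract T)
  have μt : ∀ d a, μ (d ⊗ₜ a) = lact (π d) a := fun _ _ => rfl
  have νt : ∀ d a, ν (d ⊗ₜ a) = lact (π (lact T d)) a := fun _ _ => rfl
  have μt' : ∀ d a, μ' (d ⊗ₜ a) = ract (π d) a := fun _ _ => rfl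
  have νt' : ∀ d a, ν' (d ⊗ₜ a) = ract (π (ract T d)) a := fun _ _ => rfl
  have key : ∀ d b z, ract (π d) b * ν z = ract (π (ract T d)) b * μ z := by
    intro d b z
    induction z using TensorProduct.induction_on with
    | zero => simp
    | tmul e a =>
      rw [μt, νt, ract_mul_eq, ract_mul_eq, ← lact_mul, ← lact_mul, ← map_mul, ← map_mul,
        ract_mul_eq]
    | add x y hx hy => rw [map_add, map_add, mul_add, mul_add, hx, hy]
  have key' : ∀ d b z, ν' z * lact (π d) b = μ' z * lact (π (lact T d)) b := by
    intro d b z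
    induction z using TensorProduct.induction_on with
    | zero => simp
    | tmul e a =>
      rw [μt', νt', ract_mul_eq, ract_mul_eq, ← lact_mul, ← lact_mul, ← map_mul, ← map_mul,
        ract_mul_eq]
    | add x y hx hy => rw [map_add, map_add, add_mul, add_mul, hx, hy]
  have ker : ∀ z, μ z = 0 → ν z = 0 := by
    intro z hz
    refine hA.right _ fun c => ?_
    refine indR (fun c => c * ν z = 0) (by simp) (fun a b ha hb => by rw [add_mul, ha, hb, add_zero])
      (fun r a ha => by rw [smul_mul_assoc, ha, smul_zero]) (fun d b => ?_) c
    rw [key, hz, mul_zero]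
  have ker' : ∀ z, μ' z = 0 → ν' z = 0 := by
    intro z hz
    refine hA.left _ fun c => ?_
    refine indL (fun c => ν' z * c = 0) (by simp) (fun a b ha hb => by rw [mul_add, ha, hb, add_zero])
      (fun r a ha => by rw [mul_smul_comm, ha, smul_zero]) (fun d b => ?_) c
    rw [key', hz, zero_mul]
  have sur : Function.Surjective μ := by
    refine indL (fun a => ∃ z, μ z = a) ⟨0, map_zero _⟩ ?_ ?_ (fun d a => ⟨d ⊗ₜ a, rfl⟩)
    · rintro _ _ ⟨x, rfl⟩ ⟨y, rfl⟩; exact ⟨x + y, map_add _ _ _⟩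
    · rintro r _ ⟨x, rfl⟩; exact ⟨r • x, map_smul _ _ _⟩
  have sur' : Function.Surjective μ' := by
    refine indR (fun a => ∃ z, μ' z = a) ⟨0, map_zero _⟩ ?_ ?_ (fun d a => ⟨d ⊗ₜ a, rfl⟩)
    · rintro _ _ ⟨x, rfl⟩ ⟨y, rfl⟩; exact ⟨x + y, map_add _ _ _⟩
    · rintro r _ ⟨x, rfl⟩; exact ⟨r • x, map_smul _ _ _⟩
  obtain ⟨s, hs⟩ := μ.exists_rightInverse_of_surjective (LinearMap.range_eq_top.2 sur)
  obtain ⟨s', hs'⟩ := μ'.exists_rightInverse_of_surjective (LinearMap.range_eq_top.2 sur')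
  have hL : ∀ z, ν (s (μ z)) = ν z := fun z => by
    rw [← sub_eq_zero, ← map_sub]
    refine ker _ ?_
    rw [map_sub, sub_eq_zero]
    exact LinearMap.congr_fun hs (μ z)
  have hR : ∀ z, ν' (s' (μ' z)) = ν' z := fun z => by
    rw [← sub_eq_zero, ← map_sub]
    refine ker' _ ?_
    rw [map_sub, sub_eq_zero]
    exact LinearMap.congr_fun hs' (μ' z)
  have hL' : ∀ d a, ν (s (lact (π d) a)) = lact (π (lact T d)) a := fun d a => hL (d ⊗ₜ a)
  have hR' : ∀ d a, ν' (s' (ract (π d) a)) = ract (π (ract T d)) a := fun d a => hR (d ⊗ₜ a)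
  refine ⟨mkMultiplier (ν ∘ₗ s) (ν' ∘ₗ s') ?_ ?_ ?_, ⟨hL', hR'⟩, ?_⟩
  · intro a b
    obtain ⟨z, rfl⟩ := sur a
    induction z using TensorProduct.induction_on with
    | zero => simp
    | tmul d a =>
      simp only [LinearMap.comp_apply, μt, hL']
      rw [← lact_mul', hL', lact_mul']
    | add x y hx hy => rw [map_add, add_mul, map_add, hx, hy, map_add, add_mul]
  · intro a b
    obtain ⟨z, rfl⟩ := sur' b
    induction z using TensorProduct.induction_on with
    | zero => simp
    | tmul d a =>
      simp only [LinearMap.comp_apply, μt', hR']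
      rw [← ract_mul', hR', ract_mul']
    | add x y hx hy => rw [map_add, mul_add, map_add, hx, hy, map_add, mul_add]
  · intro a b
    obtain ⟨z, rfl⟩ := sur b
    induction z using TensorProduct.induction_on with
    | zero => simp
    | tmul d b =>
      obtain ⟨w, rfl⟩ := sur' a
      simp only [LinearMap.comp_apply, hR, μt, hL']
      exact key' d b w
    | add x y hx hy => rw [map_add, map_add, mul_add, mul_add, hx, hy]
  · rintro W ⟨h1, h2⟩
    refine Subtype.ext (Prod.ext (LinearMap.ext fun a => ?_)
      (MulOpposite.unop_injective (LinearMap.ext fun a => ?_)))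
    · obtain ⟨z, rfl⟩ := sur a
      change lact W (μ z) = ν (s (μ z))
      rw [hL]
      induction z using TensorProduct.induction_on with
      | zero => simp
      | tmul d a => exact h1 d a
      | add x y hx hy => rw [map_add, map_add, map_add, hx, hy]
    · obtain ⟨z, rfl⟩ := sur' a
      change ract W (μ' z) = ν' (s' (μ' z))
      rw [hR]
      induction z using TensorProduct.induction_on with
      | zero => simp
      | tmul d a => exact h2 d a
      | add x y hx hy => rw [map_add, map_add, map_add, hx, hy]

/-- The extension of a non-degenerate homomorphism `π : D → M(A)` to a map `M(D) → M(A)`. -/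
def extend (hA : IsNondegenerateAlg A) (π : D →ₙₐ[ℂ] Multiplier A)
    (hπ : IsNondegenerateHom π) (T : Multiplier D) : Multiplier A :=
  (exists_unique_extension hA π hπ T).choose

theorem extend_spec (hA : IsNondegenerateAlg A) (π : D →ₙₐ[ℂ] Multiplier A)
    (hπ : IsNondegenerateHom π) (T : Multiplier D) :
    (∀ (d : D) (a : A), lact (extend hA π hπ T) (lact (π d) a) = lact (π (lact T d)) a) ∧
    (∀ (d : D) (a : A), ract (extend hA π hπ T) (ract (π d) a) = ract (π (ract T d)) a) :=
  (exists_unique_extension hA π hπ T).choose_spec.1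

end Morphisms

section ExtendedComultiplication

variable {A : Type*} [NonUnitalRing A] [Module ℂ A] [IsScalarTower ℂ A A] [SMulCommClass ℂ A A]
  (𝒜 : RegularMultiplierHopfAlgebroid A)

/-- `W` is the value at `T ∈ M(A)` of the unique extension of `Δ_C` to a homomorphism on `M(A)`,
that is, `W Δ_C(c)(a ⊗ b) = Δ_C(T c)(a ⊗ b)`. -/
def IsExtendedΔC (T : Multiplier A) (W : Module.End ℂ 𝒜.TC) : Prop :=
  ∀ a b c : A, W (𝒜.ΔC c (𝒜.tc a b)) = 𝒜.ΔC (lact T c) (𝒜.tc a b)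

/-- `W` is the map `u ↦ u Δ_B(T)`, where `Δ_B(T)` is the value at `T ∈ M(A)` of the unique
extension of `Δ_B` to a homomorphism on `M(A)`, that is,
`(a ⊗ b) Δ_B(c) W = (a ⊗ b) Δ_B(c T)`. -/
def IsExtendedΔB (T : Multiplier A) (W : Module.End ℂ 𝒜.TB) : Prop :=
  ∀ a b c : A, W ((𝒜.ΔB c).unop (𝒜.tb a b)) = (𝒜.ΔB (ract T c)).unop (𝒜.tb a b)

end ExtendedComultiplication

section Morphisms

variable {D : Type*} [NonUnitalRing D] [Module ℂ D] [IsScalarTower ℂ D D] [SMulCommClass ℂ D D]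
  {A : Type*} [NonUnitalRing A] [Module ℂ A] [IsScalarTower ℂ A A] [SMulCommClass ℂ A A]

/-- The linear map `d ↦ π(d) a`. -/
def homL (π : D →ₙₐ[ℂ] Multiplier A) (a : A) : D →ₗ[ℂ] A :=
  lactHom.flip a ∘ₗ ⟨⟨π, map_add π⟩, map_smul π⟩

/-- The linear map `d ↦ a π(d)`. -/
def homR (π : D →ₙₐ[ℂ] Multiplier A) (a : A) : D →ₗ[ℂ] A :=
  ractHom.flip a ∘ₗ ⟨⟨π, map_add π⟩, map_smul π⟩

/-- A homomorphism `π : D → M(A)` is a morphism of regular multiplier Hopf algebroids from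
`𝒟 = (D, E, F, t_E, t_F, Δ_E, Δ_F)` to `𝒜 = (A, B, C, t_B, t_C, Δ_B, Δ_C)`.
In the code, `E` and `F` are `𝒟.B` and `𝒟.C`, and `extend _ π _` is the extension of `π` to
multipliers. -/
structure IsMorphism (𝒟 : RegularMultiplierHopfAlgebroid D) (𝒜 : RegularMultiplierHopfAlgebroid A)
    (π : D →ₙₐ[ℂ] Multiplier A) : Prop where
  nondegenerate : IsNondegenerateHom π
  /-- `π(E) B = B`. -/
  base_EB : Submodule.span ℂ {T : Multiplier A | ∃ (e : 𝒟.B) (x : 𝒜.B),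
    T = extend 𝒜.nondegenerate π nondegenerate e.1 * x.1} = 𝒜.B.toSubmodule
  /-- `B π(E) = B`. -/
  base_BE : Submodule.span ℂ {T : Multiplier A | ∃ (e : 𝒟.B) (x : 𝒜.B),
    T = x.1 * extend 𝒜.nondegenerate π nondegenerate e.1} = 𝒜.B.toSubmodule
  /-- `π(F) C = C`. -/
  base_FC : Submodule.span ℂ {T : Multiplier A | ∃ (f : 𝒟.C) (y : 𝒜.C),
    T = extend 𝒜.nondegenerate π nondegenerate f.1 * y.1} = 𝒜.C.toSubmodule
  /-- `C π(F) = C`. -/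
  base_CF : Submodule.span ℂ {T : Multiplier A | ∃ (f : 𝒟.C) (y : 𝒜.C),
    T = y.1 * extend 𝒜.nondegenerate π nondegenerate f.1} = 𝒜.C.toSubmodule
  /-- `π(t_E(e)) = t_B(π(e))` in `M(C)`, where the extension of the anti-isomorphism `t_B` to
  `M(B)` is determined by `t_B(T) t_B(x) = t_B(x T)` and `t_B(x) t_B(T) = t_B(T x)`. -/
  base_tB : ∀ (e : 𝒟.B) (x x' : 𝒜.B),
    (x'.1 = x.1 * extend 𝒜.nondegenerate π nondegenerate e.1 →
      extend 𝒜.nondegenerate π nondegenerate (𝒟.tB e).1 * (𝒜.tB x).1 = (𝒜.tB x').1) ∧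
    (x'.1 = extend 𝒜.nondegenerate π nondegenerate e.1 * x.1 →
      (𝒜.tB x).1 * extend 𝒜.nondegenerate π nondegenerate (𝒟.tB e).1 = (𝒜.tB x').1)
  /-- `π(t_F(f)) = t_C(π(f))` in `M(B)`, with the same convention. -/
  base_tC : ∀ (f : 𝒟.C) (y y' : 𝒜.C),
    (y'.1 = y.1 * extend 𝒜.nondegenerate π nondegenerate f.1 →
      extend 𝒜.nondegenerate π nondegenerate (𝒟.tC f).1 * (𝒜.tC y).1 = (𝒜.tC y').1) ∧
    (y'.1 = extend 𝒜.nondegenerate π nondegenerate f.1 * y.1 →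
      (𝒜.tC y).1 * extend 𝒜.nondegenerate π nondegenerate (𝒟.tC f).1 = (𝒜.tC y').1)
  /-- `(a π(d') ⊗ a' π(d'')) Δ_B(π(d)) = (a ⊗ a') (π ⊗ π)((d' ⊗ d'') Δ_E(d))`. The right hand side
  is the image of `(d' ⊗ d'') Δ_E(d)` under the map `p ⊗ q ↦ a π(p) ⊗ a' π(q)` from `D_E ⊗ ^E D` to
  `A_B ⊗ ^B A`, which is well-defined by the conditions on the base algebras. -/
  comul_B : ∀ d : D, ∃ W : Module.End ℂ 𝒜.TB, IsExtendedΔB 𝒜 (π d) W ∧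
    ∀ (a a' : A) (d' d'' : D),
      Bal.Sends (𝒜.tb.compl₁₂ (homR π a) (homR π a')) ((𝒟.ΔB d).unop (𝒟.tb d' d''))
        (W (𝒜.tb (ract (π d') a) (ract (π d'') a')))
  /-- `Δ_C(π(d)) (π(d') a ⊗ π(d'') a') = (π ⊗ π)(Δ_F(d) (d' ⊗ d'')) (a ⊗ a')`. The right hand side
  is the image of `Δ_F(d) (d' ⊗ d'')` under the map `p ⊗ q ↦ π(p) a ⊗ π(q) a'` from `D^F ⊗ _F D` to
  `A^C ⊗ _C A`, which is well-defined by the conditions on the base algebras. -/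
  comul_C : ∀ d : D, ∃ W : Module.End ℂ 𝒜.TC, IsExtendedΔC 𝒜 (π d) W ∧
    ∀ (a a' : A) (d' d'' : D),
      Bal.Sends (𝒜.tc.compl₁₂ (homL π a) (homL π a')) (𝒟.ΔC d (𝒟.tc d' d''))
        (W (𝒜.tc (lact (π d') a) (lact (π d'') a')))

end Morphisms

end MultHopf

end

noncomputable section

namespace MultHopf

/-! ### Maps induced on balanced tensor products. -/

section Sends

variable {A : Type*} [NonUnitalRing A] [Module ℂ A] {ι : Type*} {f g : ι → A →ₗ[ℂ] A}
  {Q : Type*} [AddCommGroup Q] [Module ℂ Q] {G : A →ₗ[ℂ] A →ₗ[ℂ] Q} {z : Bal f g} {r : Q}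

/-! The antipode is pinned down by the formal identity `a₁ m₁ g ⊗ a₂ m₂ S(m₃) b = a₁ m g ⊗ a₂ b`:
for `p ⊗ q = (a ⊗ 1) Δ_B(m)` one has `Δ_C(p)(g ⊗ S(q) b) = Δ_C(a)(m g ⊗ b)` (`canon_lamT`). It
follows from the mixed co-associativity `coassoc_CB` by contracting the last two legs with the
antipode and then applying the left counit.

For a morphism `π`, compare two maps on `D_E ⊗ ^E D` that send `p ⊗ q` to `Δ_C(a π(p))(g ⊗ S_A(π(q))
b)` and to `Δ_C(a π(p))(g ⊗ π(S_D(q)) b)`. On `(d' ⊗ 1) Δ_E(d)` both give `Δ_C(a π(d'))(π(d) g ⊗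
b)`: the first by the identity in `A` and compatibility of `π` with the right comultiplications
(`sends_antipodeComp`), the second by the identity in `D` and compatibility with the left ones
(`sends_compAntipode`).

The elements `(d' ⊗ 1) Δ_E(d)` span the balanced tensor product (`lamT_hom_ext`), so the maps agree
on every `p ⊗ q`. Since `A π(D) = A`, the difference `z` of the two images of `b` satisfies
`Δ_C(a)(g ⊗ z) = 0` for all `a, g`, and the counit forces `z = 0` (`eq_zero_of_ΔC_eq_zero`). -/

theorem Bal.Sends.lift_congr (h : Bal.Sends G z r) {u v : A ⊗[ℂ] A}
    (huv : (balRel f g).mkQ u = (balRel f g).mkQ v) :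
    TensorProduct.lift G u = TensorProduct.lift G v := by
  obtain ⟨w, hw⟩ := (balRel f g).mkQ_surjective z
  -- Shifting a representative `w` of `z` by `u - v` gives another representative, so the lift
  -- vanishes on `u - v`.
  have h1 := h (w + (u - v)) (by rw [map_add, map_sub, huv, sub_self, add_zero, hw])
  rw [map_add, map_sub, h w hw] at h1
  exact sub_eq_zero.1 (add_eq_left.1 h1)

/-- `Bal.Sends` quantifies over all representatives, so one instance, whatever `z` is, already makes
`G` balanced. -/
theorem Bal.Sends.balRel_le (h : Bal.Sends G z r) :
    balRel f g ≤ LinearMap.ker (TensorProduct.lift G) := fun u hu => by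
  rw [LinearMap.mem_ker, h.lift_congr (v := 0) (by simpa using hu), map_zero]

/-- The linear map on a balanced tensor product that is induced by a bilinear map. -/
def Bal.lift (G : A →ₗ[ℂ] A →ₗ[ℂ] Q) (hG : balRel f g ≤ LinearMap.ker (TensorProduct.lift G)) :
    Bal f g →ₗ[ℂ] Q :=
  Submodule.liftQ _ _ hG

theorem balRel_le_ker_lift (hG : ∀ i a b, G (f i a) b = G a (g i b)) :
    balRel f g ≤ LinearMap.ker (TensorProduct.lift G) := by
  refine Submodule.span_le.2 ?_
  rintro _ ⟨i, a, b, rfl⟩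
  rw [SetLike.mem_coe, LinearMap.mem_ker, map_sub, TensorProduct.lift.tmul,
    TensorProduct.lift.tmul, sub_eq_zero, hG]

end Sends

/-! ### Separation by non-degeneracy, idempotence and generators. -/

section Ext

variable {A : Type*} [NonUnitalRing A]

theorem IsNondegenerateAlg.eq_left (hA : IsNondegenerateAlg A) {a b : A}
    (h : ∀ c, a * c = b * c) : a = b :=
  sub_eq_zero.1 (hA.left _ fun c => by rw [sub_mul, h, sub_self])

theorem IsNondegenerateAlg.eq_right (hA : IsNondegenerateAlg A) {a b : A}
    (h : ∀ c, c * a = c * b) : a = b :=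
  sub_eq_zero.1 (hA.right _ fun c => by rw [mul_sub, h, sub_self])

variable [Module ℂ A]

theorem IsIdempotentAlg.linearMap_ext (hA : IsIdempotentAlg A) {Q : Type*} [AddCommGroup Q]
    [Module ℂ Q] {φ ψ : A →ₗ[ℂ] Q} (h : ∀ a b, φ (a * b) = ψ (a * b)) : φ = ψ :=
  LinearMap.ext_on hA (by rintro _ ⟨a, b, rfl⟩; exact h a b)

variable [IsScalarTower ℂ A A] [SMulCommClass ℂ A A]

/-- The left action determines the right one through `(a T) b = a (T b)`. -/
theorem IsNondegenerateAlg.multiplier_ext (hA : IsNondegenerateAlg A) {T W : Multiplier A}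
    (h : ∀ a, lact T a = lact W a) : T = W := by
  refine Subtype.ext (Prod.ext (LinearMap.ext h)
    (MulOpposite.unop_injective (LinearMap.ext fun a => hA.eq_left fun b => ?_)))
  change ract T a * b = ract W a * b
  rw [ract_mul_eq, ract_mul_eq, h]

end Ext

namespace BaseData

variable {A : Type*} [NonUnitalRing A] [Module ℂ A] [IsScalarTower ℂ A A] [SMulCommClass ℂ A A]
  (𝒜 : BaseData A)

theorem tc_balanced (y : 𝒜.C) (a b : A) : 𝒜.tc (𝒜.actCr y a) b = 𝒜.tc a (𝒜.actCl y b) :=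
  (Submodule.Quotient.eq _).2 (Submodule.subset_span ⟨y, a, b, rfl⟩)

theorem tb_balanced (x : 𝒜.B) (a b : A) : 𝒜.tb (𝒜.actBr x a) b = 𝒜.tb a (𝒜.actBl x b) :=
  (Submodule.Quotient.eq _).2 (Submodule.subset_span ⟨x, a, b, rfl⟩)

theorem TC_hom_ext {Q : Type*} [AddCommGroup Q] [Module ℂ Q] {φ ψ : 𝒜.TC →ₗ[ℂ] Q}
    (h : ∀ a b, φ (𝒜.tc a b) = ψ (𝒜.tc a b)) : φ = ψ :=
  Submodule.linearMap_qext _ (TensorProduct.ext' h)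

theorem TB_hom_ext {Q : Type*} [AddCommGroup Q] [Module ℂ Q] {φ ψ : 𝒜.TB →ₗ[ℂ] Q}
    (h : ∀ a b, φ (𝒜.tb a b) = ψ (𝒜.tb a b)) : φ = ψ :=
  Submodule.linearMap_qext _ (TensorProduct.ext' h)

end BaseData

/-! ### Bilinearity of the left comultiplication. -/

namespace PreBialgebroid

variable {A : Type*} [NonUnitalRing A] [Module ℂ A] [IsScalarTower ℂ A A] [SMulCommClass ℂ A A]
  (𝒜 : PreBialgebroid A)

/-- `Δ_C(a x)(p ⊗ q) = Δ_C(a)(p ⊗ x q)` for `x ∈ B`. -/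
theorem ΔC_actBr (x : 𝒜.B) (a p q : A) :
    𝒜.ΔC (𝒜.actBr x a) (𝒜.tc p q) = 𝒜.ΔC a (𝒜.tc p (lact x.1 q)) := by
  let φ : A →ₗ[ℂ] 𝒜.TC :=
    { toFun := fun a => 𝒜.ΔC (𝒜.actBr x a) (𝒜.tc p q)
      map_add' := by simp
      map_smul' := by simp }
  let ψ : A →ₗ[ℂ] 𝒜.TC :=
    { toFun := fun a => 𝒜.ΔC a (𝒜.tc p (lact x.1 q))
      map_add' := by simp
      map_smul' := by simp }
  suffices h : φ = ψ from LinearMap.congr_fun h a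
  have ext : ∀ (s : A → Prop) (φ' ψ' : A →ₗ[ℂ] 𝒜.TC), Submodule.span ℂ {a | s a} = ⊤ →
      (∀ a, s a → φ' a = ψ' a) → φ' = ψ' := fun s φ' ψ' hs h => LinearMap.ext_on hs h
  -- The bilinearity axiom only covers elements with factors from `B` and `C` on both sides; the
  -- four idempotence conditions supply these one at a time.
  refine ext _ _ _ 𝒜.idem_AC ?_
  rintro _ ⟨y', a, rfl⟩
  refine LinearMap.congr_fun (ext _ (φ ∘ₗ ract y'.1) (ψ ∘ₗ ract y'.1) 𝒜.idem_AB ?_) a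
  rintro _ ⟨x', a, rfl⟩
  refine LinearMap.congr_fun (ext _ (φ ∘ₗ ract y'.1 ∘ₗ ract x'.1) (ψ ∘ₗ ract y'.1 ∘ₗ ract x'.1)
    𝒜.idem_BA ?_) a
  rintro _ ⟨x₁, a, rfl⟩
  refine LinearMap.congr_fun (ext _ (φ ∘ₗ ract y'.1 ∘ₗ ract x'.1 ∘ₗ lact x₁.1)
    (ψ ∘ₗ ract y'.1 ∘ₗ ract x'.1 ∘ₗ lact x₁.1) 𝒜.idem_CA ?_) a
  rintro _ ⟨y₁, a, rfl⟩
  change 𝒜.ΔC (ract x.1 (ract y'.1 (ract x'.1 (lact x₁.1 (lact y₁.1 a))))) (𝒜.tc p q) =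
    𝒜.ΔC (ract y'.1 (ract x'.1 (lact x₁.1 (lact y₁.1 a)))) (𝒜.tc p (lact x.1 q))
  -- As `B` and `C` commute, `x` moves past `y'` and is absorbed into `x'`.
  rw [← ract_mul, ← 𝒜.comm, ract_mul, ← ract_mul x'.1 x.1]
  have h : 𝒜.tcBase y' (x' * x) (𝒜.tc p q) = 𝒜.tcBase y' x' (𝒜.tc p (lact x.1 q)) := rfl
  rw [𝒜.ΔC_bilinear x₁ x' y₁ y' a, ← h, ← 𝒜.ΔC_bilinear x₁ (x' * x) y₁ y' a]
  rfl

/-- The map `p ⊗ q ↦ ((g, b) ↦ Δ_C(α(p))(g ⊗ σ(q) b))`. -/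
def comulMap {X Y : Type*} [AddCommGroup X] [Module ℂ X] [AddCommGroup Y] [Module ℂ Y]
    (α : X →ₗ[ℂ] A) (σ : Y →ₗ[ℂ] Module.End ℂ A) : X →ₗ[ℂ] Y →ₗ[ℂ] A →ₗ[ℂ] A →ₗ[ℂ] 𝒜.TC :=
  LinearMap.mk₂ ℂ (fun p q => (𝒜.tc.compr₂ (𝒜.ΔC (α p))).compl₂ (σ q))
    (by intros; ext; simp) (by intros; ext; simp) (by intros; ext; simp) (by intros; ext; simp)

theorem comulMap_apply {X Y : Type*} [AddCommGroup X] [Module ℂ X] [AddCommGroup Y] [Module ℂ Y]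
    (α : X →ₗ[ℂ] A) (σ : Y →ₗ[ℂ] Module.End ℂ A) (p : X) (q : Y) (g b : A) :
    𝒜.comulMap α σ p q g b = 𝒜.ΔC (α p) (𝒜.tc g (σ q b)) := rfl

end PreBialgebroid

/-! ### Antipode identities for elements covered on the other leg. -/

namespace RegularMultiplierHopfAlgebroid

variable {A : Type*} [NonUnitalRing A] [Module ℂ A] [IsScalarTower ℂ A A] [SMulCommClass ℂ A A]
  (𝒜 : RegularMultiplierHopfAlgebroid A)

/-- On `B` the antipode inverts `t_C`. Together with `S_actBl`, this makes the contractions with the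
antipode respect the balancing. -/
theorem S_actCr (y : 𝒜.C) (a : A) : 𝒜.S (𝒜.actCr y a) = ract y.1 (𝒜.S a) := by
  have h := congrArg (fun T => ract T (𝒜.S a)) (𝒜.S_B (𝒜.tC y))
  rw [LinearEquiv.symm_apply_apply] at h
  rw [← h]
  change _ = 𝒜.S (lact _ (𝒜.S.symm (𝒜.S a)))
  rw [LinearEquiv.symm_apply_apply]; rfl

theorem S_actBl (x : 𝒜.B) (a : A) : 𝒜.S (𝒜.actBl x a) = lact x.1 (𝒜.S a) := by
  have h := congrArg (fun T => lact T (𝒜.S a)) (𝒜.S_C (𝒜.tB x))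
  rw [LinearEquiv.symm_apply_apply] at h
  rw [← h]
  change _ = 𝒜.S (ract _ (𝒜.S.symm (𝒜.S a)))
  rw [LinearEquiv.symm_apply_apply]; rfl

/-- `p S(q) = ε_C(a) S(c)` for `p ⊗ q = (1 ⊗ c) Δ_B(a)`. -/
theorem antipode_rhoT (a c : A) :
    Bal.Sends ((LinearMap.mul ℂ A).compl₂ 𝒜.S.toLinearMap) (𝒜.rhoT a c)
      (lact (𝒜.εC a).1 (𝒜.S c)) := by
  intro u hu
  -- Multiplying by `e` leads to `(e ⊗ c) Δ_B(a) = (1 ⊗ c)((e ⊗ 1) Δ_B(a))`, where the antipode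
  -- axiom applies; `c` comes out on the right as `S(c)`.
  refine 𝒜.nondegenerate.eq_right fun e => ?_
  obtain ⟨v, hv⟩ := Submodule.mkQ_surjective _ (𝒜.lamT e a)
  have h := 𝒜.antipode_right e a
  have h1 := h.lift_congr (u := TensorProduct.map (LinearMap.mulLeft ℂ e) LinearMap.id u)
    (v := TensorProduct.map LinearMap.id (LinearMap.mulLeft ℂ c) v)
    ((congrArg (𝒜.tbMul1 e) hu).trans ((𝒜.rhoT_spec a c e).trans
      ((𝒜.lamT_spec e a c).symm.trans (congrArg (𝒜.tbMul2 c) hv).symm)))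
  have h2 : TensorProduct.lift ((LinearMap.mul ℂ A).compl₂ 𝒜.S.toLinearMap) ∘ₗ
      TensorProduct.map (LinearMap.mulLeft ℂ e) LinearMap.id = LinearMap.mulLeft ℂ e ∘ₗ
      TensorProduct.lift ((LinearMap.mul ℂ A).compl₂ 𝒜.S.toLinearMap) :=
    TensorProduct.ext' fun p q => by simp [mul_assoc]
  have h3 : TensorProduct.lift ((LinearMap.mul ℂ A).compl₂ 𝒜.S.toLinearMap) ∘ₗ
      TensorProduct.map LinearMap.id (LinearMap.mulLeft ℂ c) = LinearMap.mulRight ℂ (𝒜.S c) ∘ₗ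
      TensorProduct.lift ((LinearMap.mul ℂ A).compl₂ 𝒜.S.toLinearMap) :=
    TensorProduct.ext' fun p q => by simp [𝒜.S_mul, mul_assoc]
  refine (LinearMap.congr_fun h2 u).symm.trans (h1.trans ((LinearMap.congr_fun h3 v).trans ?_))
  rw [LinearMap.comp_apply, h v hv, LinearMap.mulRight_apply, ract_mul_eq]

/-- `S(p) q = S(g) ε_B(a)` for `p ⊗ q = Δ_C(a)(g ⊗ 1)`. -/
theorem antipode_Tlam (g a : A) :
    Bal.Sends (LinearMap.mul ℂ A ∘ₗ 𝒜.S.toLinearMap) (𝒜.Tlam g a)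
      (ract (𝒜.εB a).1 (𝒜.S g)) := by
  intro u hu
  -- Mirror argument, using the two ways of covering `Δ_C(a)(g ⊗ e)`.
  refine 𝒜.nondegenerate.eq_left fun e => ?_
  obtain ⟨v, hv⟩ := Submodule.mkQ_surjective _ (𝒜.Trho a e)
  have h := 𝒜.antipode_left a e
  have h1 := h.lift_congr (u := TensorProduct.map LinearMap.id (LinearMap.mulRight ℂ e) u)
    (v := TensorProduct.map (LinearMap.mulRight ℂ g) LinearMap.id v)
    ((congrArg (𝒜.tcMul2 e) hu).trans ((𝒜.Tlam_spec g a e).trans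
      ((𝒜.Trho_spec a e g).symm.trans (congrArg (𝒜.tcMul1 g) hv).symm)))
  have h2 : TensorProduct.lift (LinearMap.mul ℂ A ∘ₗ 𝒜.S.toLinearMap) ∘ₗ
      TensorProduct.map LinearMap.id (LinearMap.mulRight ℂ e) = LinearMap.mulRight ℂ e ∘ₗ
      TensorProduct.lift (LinearMap.mul ℂ A ∘ₗ 𝒜.S.toLinearMap) :=
    TensorProduct.ext' fun p q => by simp [mul_assoc]
  have h3 : TensorProduct.lift (LinearMap.mul ℂ A ∘ₗ 𝒜.S.toLinearMap) ∘ₗ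
      TensorProduct.map (LinearMap.mulRight ℂ g) LinearMap.id = LinearMap.mulLeft ℂ (𝒜.S g) ∘ₗ
      TensorProduct.lift (LinearMap.mul ℂ A ∘ₗ 𝒜.S.toLinearMap) :=
    TensorProduct.ext' fun p q => by simp [𝒜.S_mul, mul_assoc]
  refine (LinearMap.congr_fun h2 u).symm.trans (h1.trans ((LinearMap.congr_fun h3 v).trans ?_))
  rw [LinearMap.comp_apply, h v hv, LinearMap.mulLeft_apply, ract_mul_eq]

/-! ### Contractions of threefold tensors and the canonical map. -/

/-- The map `p ⊗ q ⊗ r ↦ p ⊗ q S(r) b` from `A^C ⊗ _C A_B ⊗ ^B A` to `A^C ⊗ _C A`. -/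
def contractRight (b : A) :
    Trip 𝒜.actCr 𝒜.actCl 𝒜.actBr 𝒜.actBl →ₗ[ℂ] 𝒜.TC :=
  Submodule.liftQ _
    (TensorProduct.lift (𝒜.tc.compl₂ (LinearMap.mulRight ℂ b ∘ₗ
      TensorProduct.lift ((LinearMap.mul ℂ A).compl₂ 𝒜.S.toLinearMap))))
    (by
      refine sup_le (Submodule.span_le.2 ?_) (Submodule.span_le.2 ?_)
      · rintro _ ⟨y, p, q, r, rfl⟩
        simp only [SetLike.mem_coe, LinearMap.mem_ker, map_sub, TensorProduct.lift.tmul,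
          LinearMap.compl₂_apply, LinearMap.comp_apply, LinearMap.mulRight_apply,
          LinearMap.mul_apply']
        rw [sub_eq_zero, 𝒜.tc_balanced]
        simp only [BaseData.actCl, lact_mul']
      · rintro _ ⟨x, p, q, r, rfl⟩
        simp only [SetLike.mem_coe, LinearMap.mem_ker, map_sub, TensorProduct.lift.tmul,
          LinearMap.compl₂_apply, LinearMap.comp_apply, LinearMap.mulRight_apply,
          LinearMap.mul_apply', LinearEquiv.coe_coe, 𝒜.S_actBl]
        rw [sub_eq_zero, BaseData.actBr, ract_mul_eq])

theorem contractRight_ins12 (b : A) (z : 𝒜.TC) (q : A) :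
    𝒜.contractRight b (ins12 _ _ _ _ z q) = 𝒜.tcMul2 (𝒜.S q * b) z := by
  refine LinearMap.congr_fun (𝒜.TC_hom_ext (φ := 𝒜.contractRight b ∘ₗ (ins12 _ _ _ _).flip q)
    fun p r => ?_) z
  change 𝒜.tc p (r * 𝒜.S q * b) = 𝒜.tc p (r * (𝒜.S q * b))
  rw [mul_assoc]

theorem contractRight_ins23 (b p : A) (u : A ⊗[ℂ] A) :
    𝒜.contractRight b (ins23 _ _ _ _ p ((balRel _ _).mkQ u)) =
      𝒜.tc p (TensorProduct.lift ((LinearMap.mul ℂ A).compl₂ 𝒜.S.toLinearMap) u * b) := rfl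

/-- The map `p ⊗ q ⊗ r ↦ a S(p) q ⊗ r` from `A^C ⊗ _C A_B ⊗ ^B A` to `A_B ⊗ ^B A`. -/
def contractLeft (a : A) :
    Trip 𝒜.actCr 𝒜.actCl 𝒜.actBr 𝒜.actBl →ₗ[ℂ] 𝒜.TB :=
  Submodule.liftQ _
    (TensorProduct.lift 𝒜.tb ∘ₗ LinearMap.rTensor A (LinearMap.mulLeft ℂ a ∘ₗ
      TensorProduct.lift (LinearMap.mul ℂ A ∘ₗ 𝒜.S.toLinearMap)) ∘ₗ
      (TensorProduct.assoc ℂ A A A).symm.toLinearMap)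
    (by
      refine sup_le (Submodule.span_le.2 ?_) (Submodule.span_le.2 ?_)
      · rintro _ ⟨y, p, q, r, rfl⟩
        simp only [SetLike.mem_coe, LinearMap.mem_ker, map_sub, TensorProduct.lift.tmul,
          LinearMap.comp_apply, LinearEquiv.coe_coe, TensorProduct.assoc_symm_tmul,
          LinearMap.rTensor_tmul, LinearMap.mulLeft_apply, LinearMap.mul_apply', 𝒜.S_actCr]
        rw [sub_eq_zero, BaseData.actCl, ract_mul_eq]
      · rintro _ ⟨x, p, q, r, rfl⟩
        simp only [SetLike.mem_coe, LinearMap.mem_ker, map_sub, TensorProduct.lift.tmul,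
          LinearMap.comp_apply, LinearEquiv.coe_coe, TensorProduct.assoc_symm_tmul,
          LinearMap.rTensor_tmul, LinearMap.mulLeft_apply, LinearMap.mul_apply']
        rw [sub_eq_zero, ← 𝒜.tb_balanced]
        simp only [BaseData.actBr, ract_mul'])

theorem contractLeft_ins12 (a : A) (u : A ⊗[ℂ] A) (r : A) :
    𝒜.contractLeft a (ins12 _ _ _ _ ((balRel _ _).mkQ u) r) =
      𝒜.tb (a * TensorProduct.lift (LinearMap.mul ℂ A ∘ₗ 𝒜.S.toLinearMap) u) r := by
  induction u using TensorProduct.induction_on with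
  | zero => simp
  | tmul p q => rfl
  | add u v hu hv => simp only [map_add, LinearMap.add_apply, hu, hv, mul_add]

theorem contractLeft_ins23 (a p : A) (z : 𝒜.TB) :
    𝒜.contractLeft a (ins23 _ _ _ _ p z) = 𝒜.tbMul1 (a * 𝒜.S p) z := by
  refine LinearMap.congr_fun (𝒜.TB_hom_ext (φ := 𝒜.contractLeft a ∘ₗ ins23 _ _ _ _ p)
    fun q r => ?_) z
  change 𝒜.tb (a * (𝒜.S p * q)) r = 𝒜.tb (a * 𝒜.S p * q) r
  rw [mul_assoc]

theorem comulMap_balanced (x : 𝒜.B) (p q : A) :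
    𝒜.comulMap LinearMap.id (LinearMap.mul ℂ A ∘ₗ 𝒜.S.toLinearMap) (𝒜.actBr x p) q =
      𝒜.comulMap LinearMap.id (LinearMap.mul ℂ A ∘ₗ 𝒜.S.toLinearMap) p (𝒜.actBl x q) :=
  LinearMap.ext₂ fun g b => by
    simp only [PreBialgebroid.comulMap_apply, LinearMap.id_apply, LinearMap.comp_apply,
      LinearEquiv.coe_coe, LinearMap.mul_apply', 𝒜.S_actBl, 𝒜.ΔC_actBr, lact_mul']

/-- The map `p ⊗ q ↦ ((g, b) ↦ Δ_C(p)(g ⊗ S(q) b))` on `A_B ⊗ ^B A`. -/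
def canon : 𝒜.TB →ₗ[ℂ] A →ₗ[ℂ] A →ₗ[ℂ] 𝒜.TC :=
  Bal.lift (Q := A →ₗ[ℂ] A →ₗ[ℂ] 𝒜.TC)
    (𝒜.comulMap LinearMap.id (LinearMap.mul ℂ A ∘ₗ 𝒜.S.toLinearMap))
    (balRel_le_ker_lift 𝒜.comulMap_balanced)

theorem canon_tb (p q g b : A) :
    𝒜.canon (𝒜.tb p q) g b = 𝒜.ΔC p (𝒜.tc g (𝒜.S q * b)) := rfl

/-- `Δ_C(p)(g ⊗ S(q) b) = a g ⊗ S(c) b` for `p ⊗ q = (1 ⊗ c) Δ_B(a)`. -/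
theorem canon_rhoT (a c g b : A) :
    𝒜.canon (𝒜.rhoT a c) g b = 𝒜.tc (a * g) (𝒜.S c * b) := by
  obtain ⟨r, h1, h2⟩ := 𝒜.coassoc_CB g a c
  obtain ⟨u, hu⟩ := Submodule.mkQ_surjective _ (𝒜.rhoT a c)
  obtain ⟨v, hv⟩ := Submodule.mkQ_surjective _ (𝒜.Tlam g a)
  -- Both sides of mixed co-associativity are contracted; this one, where `Δ_C` hits the first leg,
  -- is the canonical map.
  have e1 : 𝒜.canon (𝒜.rhoT a c) g b = 𝒜.contractRight b r := by
    rw [← h1 u hu, ← hu]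
    clear hu
    induction u using TensorProduct.induction_on with
    | zero => simp
    | tmul p q =>
      rw [TensorProduct.lift.tmul, LinearMap.comp_apply, contractRight_ins12, 𝒜.Tlam_spec]
      rfl
    | add u v hu hv => simp only [map_add, LinearMap.add_apply, hu, hv]
  -- Here the last two legs collapse to `ε_C(q) S(c)`; balancing moves `ε_C(q)` to the first leg as
  -- `t_C(ε_C(q))`, and the counit identity yields `a g`.
  have e2 : 𝒜.contractRight b r = 𝒜.tc (a * g) (𝒜.S c * b) := by
    rw [← h2 v hv, ← 𝒜.isLeftCounit.counit_lam a g v hv]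
    clear hv
    induction v using TensorProduct.induction_on with
    | zero => simp
    | tmul p q =>
      obtain ⟨w, hw⟩ := Submodule.mkQ_surjective _ (𝒜.rhoT q c)
      rw [TensorProduct.lift.tmul, LinearMap.compl₂_apply, LinearMap.flip_apply, ← hw,
        contractRight_ins23, 𝒜.antipode_rhoT q c w hw, ← lact_mul']
      exact (𝒜.tc_balanced _ _ _).symm
    | add u v hu hv => simp only [map_add, LinearMap.add_apply, hu, hv]
  rw [e1, e2]

theorem canon_tbMul1 (a : A) (z : 𝒜.TB) (g b : A) :
    𝒜.canon (𝒜.tbMul1 a z) g b = 𝒜.ΔC a (𝒜.canon z g b) := by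
  obtain ⟨u, rfl⟩ := Submodule.mkQ_surjective _ z
  induction u using TensorProduct.induction_on with
  | zero => simp
  | tmul p q =>
    change 𝒜.ΔC (a * p) (𝒜.tc g (𝒜.S q * b)) = 𝒜.ΔC a (𝒜.ΔC p (𝒜.tc g (𝒜.S q * b)))
    rw [map_mul]; rfl
  | add u v hu hv => simp only [map_add, LinearMap.add_apply, hu, hv]

theorem canon_tbMul2 (c : A) (z : 𝒜.TB) (g b : A) :
    𝒜.canon (𝒜.tbMul2 c z) g b = 𝒜.canon z g (𝒜.S c * b) := by
  obtain ⟨u, rfl⟩ := Submodule.mkQ_surjective _ z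
  induction u using TensorProduct.induction_on with
  | zero => simp
  | tmul p q =>
    change 𝒜.ΔC p (𝒜.tc g (𝒜.S (c * q) * b)) = 𝒜.ΔC p (𝒜.tc g (𝒜.S q * (𝒜.S c * b)))
    rw [𝒜.S_mul, mul_assoc]
  | add u v hu hv => simp only [map_add, LinearMap.add_apply, hu, hv]

/-- Since `(a ⊗ c) Δ_B(m) = (a ⊗ 1)((1 ⊗ c) Δ_B(m))`, multiplicativity of `Δ_C` pulls `a` out of
`canon_rhoT`. -/
theorem canon_ΔB (a c m g b : A) :
    𝒜.canon ((𝒜.ΔB m).unop (𝒜.tb a c)) g b = 𝒜.ΔC a (𝒜.tc (m * g) (𝒜.S c * b)) := by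
  rw [← 𝒜.rhoT_spec, canon_tbMul1, canon_rhoT]

/-- `Δ_C(p)(g ⊗ S(q) b) = Δ_C(a)(m g ⊗ b)` for `p ⊗ q = (a ⊗ 1) Δ_B(m)`. -/
theorem canon_lamT (a m g b : A) :
    𝒜.canon (𝒜.lamT a m) g b = 𝒜.ΔC a (𝒜.tc (m * g) b) := by
  -- Products `S(c) b` span `A`, and the factor `S(c)` provides the missing cover `1 ⊗ c`.
  refine LinearMap.congr_fun (𝒜.idempotent.linearMap_ext (φ := 𝒜.canon (𝒜.lamT a m) g)
    (ψ := 𝒜.ΔC a ∘ₗ 𝒜.tc (m * g)) fun s b => ?_) b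
  obtain ⟨c, rfl⟩ := 𝒜.S.surjective s
  rw [← canon_tbMul2, 𝒜.lamT_spec, canon_ΔB]
  rfl

/-! ### Spanning and faithfulness. -/

/-- The elements `(a ⊗ 1) Δ_B(b)` span `A_B ⊗ ^B A`. -/
theorem lamT_hom_ext {Q : Type*} [AddCommGroup Q] [Module ℂ Q] {φ ψ : 𝒜.TB →ₗ[ℂ] Q}
    (hφ : ∀ a b, φ (𝒜.lamT a b) = ψ (𝒜.lamT a b)) : φ = ψ := by
  refine 𝒜.TB_hom_ext fun a b => ?_
  refine LinearMap.congr_fun (𝒜.idempotent.linearMap_ext (φ := φ ∘ₗ 𝒜.tb.flip b)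
    (ψ := ψ ∘ₗ 𝒜.tb.flip b) fun a s => ?_) a
  obtain ⟨g, rfl⟩ := 𝒜.S.surjective s
  change φ (𝒜.tb (a * 𝒜.S g) b) = ψ (𝒜.tb (a * 𝒜.S g) b)
  obtain ⟨v, hv⟩ := Submodule.mkQ_surjective _ (𝒜.Tlam g b)
  -- Formally `a S(b₁ g) b₂ ⊗ b₃ = a S(g) ε_B(b₁) ⊗ b₂ = a S(g) ⊗ b`. This is checked after covering
  -- the second leg by `c`, by applying `contractLeft` to mixed co-associativity.
  have h : TensorProduct.lift (𝒜.lamT ∘ₗ LinearMap.mulLeft ℂ a ∘ₗ 𝒜.S.toLinearMap) v =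
      𝒜.tb (a * 𝒜.S g) b := by
    refine sub_eq_zero.1 (𝒜.nondeg_TB2 _ fun c => ?_)
    rw [map_sub, sub_eq_zero]
    obtain ⟨r, h1, h2⟩ := 𝒜.coassoc_CB g b c
    obtain ⟨u, hu⟩ := Submodule.mkQ_surjective _ (𝒜.rhoT b c)
    have e1 : 𝒜.contractLeft a r = 𝒜.tb (a * 𝒜.S g) (c * b) := by
      rw [← h1 u hu, ← 𝒜.isRightCounit.counit_rho b c u hu]
      clear hu
      induction u using TensorProduct.induction_on with
      | zero => simp
      | tmul p q =>
        obtain ⟨w, hw⟩ := Submodule.mkQ_surjective _ (𝒜.Tlam g p)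
        rw [TensorProduct.lift.tmul, LinearMap.comp_apply, ← hw,
          contractLeft_ins12, 𝒜.antipode_Tlam g p w hw, ← ract_mul']
        exact 𝒜.tb_balanced _ _ _
      | add u v hu hv => simp only [map_add, hu, hv]
    refine Eq.trans ?_ e1
    rw [← h2 v hv]
    clear hv
    induction v using TensorProduct.induction_on with
    | zero => simp
    | tmul p q =>
      rw [TensorProduct.lift.tmul, TensorProduct.lift.tmul, LinearMap.compl₂_apply,
        contractLeft_ins23]
      exact (𝒜.lamT_spec _ _ _).trans (𝒜.rhoT_spec _ _ _).symm
    | add u v hu hv => simp only [map_add, hu, hv]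
  rw [← h]
  clear hv h
  induction v using TensorProduct.induction_on with
  | zero => simp
  | tmul p q => exact hφ _ _
  | add u v hu hv => simp only [map_add, hu, hv]

theorem eq_of_sends_lamT {Q : Type*} [AddCommGroup Q] [Module ℂ Q] {G H : A →ₗ[ℂ] A →ₗ[ℂ] Q}
    {r : A → A → Q} (hG : ∀ a b, Bal.Sends G (𝒜.lamT a b) (r a b))
    (hH : ∀ a b, Bal.Sends H (𝒜.lamT a b) (r a b)) : G = H := by
  -- The zeros are arbitrary: any instance shows that `G` and `H` are balanced.
  have h : Bal.lift G (hG 0 0).balRel_le = Bal.lift H (hH 0 0).balRel_le := by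
    refine 𝒜.lamT_hom_ext fun a b => ?_
    obtain ⟨u, hu⟩ := Submodule.mkQ_surjective _ (𝒜.lamT a b)
    rw [← hu]
    exact (hG a b u hu).trans (hH a b u hu).symm
  exact LinearMap.ext₂ fun p q => LinearMap.congr_fun h (𝒜.tb p q)

/-- The elements `(a ⊗ b) Δ_B(c)` span `A_B ⊗ ^B A`. -/
theorem ΔB_hom_ext {Q : Type*} [AddCommGroup Q] [Module ℂ Q] {φ ψ : 𝒜.TB →ₗ[ℂ] Q}
    (h : ∀ a b c, φ ((𝒜.ΔB c).unop (𝒜.tb a b)) = ψ ((𝒜.ΔB c).unop (𝒜.tb a b))) : φ = ψ := by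
  refine 𝒜.TB_hom_ext fun a b => ?_
  refine LinearMap.congr_fun (𝒜.idempotent.linearMap_ext (φ := φ ∘ₗ 𝒜.tb a)
    (ψ := ψ ∘ₗ 𝒜.tb a) fun c b => ?_) b
  -- Left multiplication by `1 ⊗ c` turns the spanning elements `(a ⊗ 1) Δ_B(m)` into `(a ⊗ c)
  -- Δ_B(m)`.
  refine LinearMap.congr_fun (𝒜.lamT_hom_ext (φ := φ ∘ₗ 𝒜.tbMul2 c)
    (ψ := ψ ∘ₗ 𝒜.tbMul2 c) fun a m => ?_) (𝒜.tb a b)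
  rw [LinearMap.comp_apply, LinearMap.comp_apply, 𝒜.lamT_spec, h]

/-- The elements `Δ_C(c)(a ⊗ b)` span `A^C ⊗ _C A`. -/
theorem ΔC_hom_ext {Q : Type*} [AddCommGroup Q] [Module ℂ Q] {φ ψ : 𝒜.TC →ₗ[ℂ] Q}
    (h : ∀ a b c, φ (𝒜.ΔC c (𝒜.tc a b)) = ψ (𝒜.ΔC c (𝒜.tc a b))) : φ = ψ := by
  refine 𝒜.TC_hom_ext fun a b => ?_
  refine LinearMap.congr_fun (𝒜.idempotent.linearMap_ext (φ := φ ∘ₗ 𝒜.tc.flip b)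
    (ψ := ψ ∘ₗ 𝒜.tc.flip b) fun m g => ?_) a
  refine LinearMap.congr_fun (𝒜.idempotent.linearMap_ext (φ := φ ∘ₗ 𝒜.tc (m * g))
    (ψ := ψ ∘ₗ 𝒜.tc (m * g)) fun s b => ?_) b
  obtain ⟨c, rfl⟩ := 𝒜.S.surjective s
  -- Read backwards, `canon_rhoT` writes `m g ⊗ S(c) b` as a sum of terms `Δ_C(p)(g ⊗ S(q) b)`.
  rw [LinearMap.comp_apply, LinearMap.comp_apply, ← canon_rhoT]
  obtain ⟨u, hu⟩ := Submodule.mkQ_surjective _ (𝒜.rhoT m c)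
  rw [← hu]
  clear hu
  induction u using TensorProduct.induction_on with
  | zero => simp
  | tmul p q => exact h _ _ _
  | add u v hu hv => simp only [map_add, LinearMap.add_apply, hu, hv]

/-- Non-degeneracy gives `Δ_C(a)(1 ⊗ z) = 0`, and the counit turns this into `a z = 0`. -/
theorem eq_zero_of_ΔC_eq_zero {z : A} (h : ∀ a g, 𝒜.ΔC a (𝒜.tc g z) = 0) : z = 0 := by
  refine 𝒜.nondegenerate.right _ fun a => ?_
  have h0 : 𝒜.Trho a z = 0 := 𝒜.nondeg_TC1 _ fun g => by rw [𝒜.Trho_spec, h]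
  have := 𝒜.isLeftCounit.counit_rho a z 0 (by rw [map_zero, h0])
  rw [← this, map_zero]

end RegularMultiplierHopfAlgebroid

/-! ### Comultiplications extended to multipliers. -/

section ExtendedComultiplication

variable {A : Type*} [NonUnitalRing A] [Module ℂ A] [IsScalarTower ℂ A A] [SMulCommClass ℂ A A]
  {𝒜 : RegularMultiplierHopfAlgebroid A} {T : Multiplier A}

/-- The definition controls products with `T` on the right only. The other side follows from `c (T
m) = (c T) m`, since the elements `(a ⊗ b) Δ_B(c)` span. -/
theorem IsExtendedΔB.ΔB_lact {W : Module.End ℂ 𝒜.TB} (h : IsExtendedΔB 𝒜 T W) (m : A)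
    (z : 𝒜.TB) : (𝒜.ΔB (lact T m)).unop z = (𝒜.ΔB m).unop (W z) := by
  refine LinearMap.congr_fun (𝒜.ΔB_hom_ext (ψ := (𝒜.ΔB m).unop ∘ₗ W) fun a b c => ?_) z
  rw [LinearMap.comp_apply, h a b c]
  have h1 := congrArg (fun V : (Module.End ℂ 𝒜.TB)ᵐᵒᵖ => V.unop (𝒜.tb a b)) (map_mul 𝒜.ΔB c (lact T m))
  have h2 := congrArg (fun V : (Module.End ℂ 𝒜.TB)ᵐᵒᵖ => V.unop (𝒜.tb a b)) (map_mul 𝒜.ΔB (ract T c) m)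
  rw [ract_mul_eq] at h2
  exact h1.symm.trans h2

theorem IsExtendedΔC.ΔC_ract {W : Module.End ℂ 𝒜.TC} (h : IsExtendedΔC 𝒜 T W) (m : A)
    (z : 𝒜.TC) : 𝒜.ΔC (ract T m) z = 𝒜.ΔC m (W z) := by
  refine LinearMap.congr_fun (𝒜.ΔC_hom_ext (ψ := 𝒜.ΔC m ∘ₗ W) fun a b c => ?_) z
  rw [LinearMap.comp_apply, h a b c]
  have h1 := congrArg (fun V => V (𝒜.tc a b)) (map_mul 𝒜.ΔC (ract T m) c)
  have h2 := congrArg (fun V => V (𝒜.tc a b)) (map_mul 𝒜.ΔC m (lact T c))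
  rw [ract_mul_eq] at h1
  exact h1.symm.trans h2

end ExtendedComultiplication

/-! ### Pushing tensors forward along a morphism. -/

namespace IsMorphism

variable {D : Type*} [NonUnitalRing D] [Module ℂ D] [IsScalarTower ℂ D D] [SMulCommClass ℂ D D]
  {A : Type*} [NonUnitalRing A] [Module ℂ A] [IsScalarTower ℂ A A] [SMulCommClass ℂ A A]
  {𝒟 : RegularMultiplierHopfAlgebroid D} {𝒜 : RegularMultiplierHopfAlgebroid A}
  {π : D →ₙₐ[ℂ] Multiplier A} (hπ : IsMorphism 𝒟 𝒜 π)

/-- The map `p ⊗ q ↦ a π(p) ⊗ a' π(q)` from `D_E ⊗ ^E D` to `A_B ⊗ ^B A`. -/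
def pushB (hπ : IsMorphism 𝒟 𝒜 π) (a a' : A) : 𝒟.TB →ₗ[ℂ] 𝒜.TB :=
  Bal.lift (𝒜.tb.compl₁₂ (homR π a) (homR π a'))
    -- The morphism axiom at zero already contains the compatibility with the balancing.
    (((hπ.comul_B 0).choose_spec.2 a a' 0 0).balRel_le)

/-- The map `p ⊗ q ↦ π(p) a ⊗ π(q) a'` from `D^F ⊗ _F D` to `A^C ⊗ _C A`. -/
def pushC (hπ : IsMorphism 𝒟 𝒜 π) (a a' : A) : 𝒟.TC →ₗ[ℂ] 𝒜.TC :=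
  Bal.lift (𝒜.tc.compl₁₂ (homL π a) (homL π a'))
    (((hπ.comul_C 0).choose_spec.2 a a' 0 0).balRel_le)

/-- Multiplying by `Δ_B(m)` replaces the extended `Δ_B(π(d))` by the comultiplication of the element
`π(d) m` of `A`. -/
theorem ΔB_pushB (m a a' : A) (d d' d'' : D) :
    (𝒜.ΔB m).unop (hπ.pushB a a' ((𝒟.ΔB d).unop (𝒟.tb d' d''))) =
      (𝒜.ΔB (lact (π d) m)).unop (𝒜.tb (ract (π d') a) (ract (π d'') a')) := by
  obtain ⟨W, hW, h⟩ := hπ.comul_B d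
  obtain ⟨u, hu⟩ := Submodule.mkQ_surjective _ ((𝒟.ΔB d).unop (𝒟.tb d' d''))
  rw [hW.ΔB_lact, ← h a a' d' d'' u hu, ← hu]
  rfl

theorem ΔC_pushC (m a a' : A) (d d' d'' : D) :
    𝒜.ΔC m (hπ.pushC a a' (𝒟.ΔC d (𝒟.tc d' d''))) =
      𝒜.ΔC (ract (π d) m) (𝒜.tc (lact (π d') a) (lact (π d'') a')) := by
  obtain ⟨W, hW, h⟩ := hπ.comul_C d
  obtain ⟨u, hu⟩ := Submodule.mkQ_surjective _ (𝒟.ΔC d (𝒟.tc d' d''))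
  rw [hW.ΔC_ract, ← h a a' d' d'' u hu, ← hu]
  rfl

end IsMorphism

/-! ### Comparison of the two antipodes. -/

section Antipode

variable {D : Type*} [NonUnitalRing D] [Module ℂ D] [IsScalarTower ℂ D D] [SMulCommClass ℂ D D]
  {A : Type*} [NonUnitalRing A] [Module ℂ A] [IsScalarTower ℂ A A] [SMulCommClass ℂ A A]
  {𝒟 : RegularMultiplierHopfAlgebroid D} {𝒜 : RegularMultiplierHopfAlgebroid A}
  {π : D →ₙₐ[ℂ] Multiplier A}

variable (𝒜 π) in
/-- The map `d ↦ S_A(π(d))`, with values in left multiplications. -/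
def antipodeComp : D →ₗ[ℂ] Module.End ℂ A where
  toFun d := lact (antiExtend 𝒜.S 𝒜.S_mul (π d))
  map_add' p q := LinearMap.ext fun a =>
    (congrArg (fun T => 𝒜.S (ract T (𝒜.S.symm a))) (map_add π p q)).trans (map_add 𝒜.S _ _)
  map_smul' r p := LinearMap.ext fun a =>
    (congrArg (fun T => 𝒜.S (ract T (𝒜.S.symm a))) (map_smul π r p)).trans (map_smul 𝒜.S _ _)

omit [IsScalarTower ℂ D D] [SMulCommClass ℂ D D] in
theorem antipodeComp_mul (d : D) (a b : A) :
    antipodeComp 𝒜 π d (𝒜.S a * b) = 𝒜.S (ract (π d) a) * b := by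
  refine (lact_mul' _ _ _).trans (congrArg (· * b) ?_)
  change 𝒜.S (ract (π d) (𝒜.S.symm (𝒜.S a))) = _
  rw [LinearEquiv.symm_apply_apply]

variable (𝒟 π) in
/-- The map `d ↦ π(S_D(d))`, with values in left multiplications. -/
def compAntipode : D →ₗ[ℂ] Module.End ℂ A where
  toFun d := lact (π (𝒟.S d))
  map_add' p q := by rw [map_add, map_add]; rfl
  map_smul' r p := by rw [map_smul, map_smul]; rfl

namespace IsMorphism

theorem sends_antipodeComp (hπ : IsMorphism 𝒟 𝒜 π) (a : A) (d d' : D) :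
    Bal.Sends (𝒜.comulMap (homR π a) (antipodeComp 𝒜 π)) (𝒟.lamT d' d)
      ((𝒜.tc.compr₂ (𝒜.ΔC (ract (π d') a))) ∘ₗ lact (π d)) := by
  intro u hu
  refine 𝒜.idempotent.linearMap_ext fun m g => ?_
  refine 𝒜.idempotent.linearMap_ext fun s b => ?_
  obtain ⟨s, rfl⟩ := 𝒜.S.surjective s
  set G := TensorProduct.lift (𝒜.comulMap (homR π a) (antipodeComp 𝒜 π)) with hG
  refine LinearMap.congr_fun (LinearMap.ext_on
    (f := G u (m * g) ∘ₗ LinearMap.mulRight ℂ b ∘ₗ 𝒜.S.toLinearMap)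
    (g := 𝒜.ΔC (ract (π d') a) ∘ₗ 𝒜.tc (lact (π d) (m * g)) ∘ₗ LinearMap.mulRight ℂ b ∘ₗ
      𝒜.S.toLinearMap) hπ.nondegenerate.right ?_) s
  rintro _ ⟨e, c, rfl⟩
  change G u (m * g) (𝒜.S (ract (π e) c) * b) = 𝒜.ΔC (ract (π d') a)
    (𝒜.tc (lact (π d) (m * g)) (𝒜.S (ract (π e) c) * b))
  -- The factor `m` allows `canon_ΔB` to be read backwards, and `c π(e)` covers the second leg, with
  -- `S_A(π(q)) S_A(c π(e)) = S_A(c π(e q))`.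
  have key : G u (m * g) (𝒜.S (ract (π e) c) * b) =
      𝒜.canon ((𝒜.ΔB m).unop (hπ.pushB a c (𝒟.tbMul2 e ((balRel _ _).mkQ u)))) g b := by
    clear hu
    induction u using TensorProduct.induction_on with
    | zero => simp
    | tmul p q =>
      rw [hG, TensorProduct.lift.tmul, PreBialgebroid.comulMap_apply, antipodeComp_mul,
        ← ract_mul, ← map_mul]
      exact (𝒜.canon_ΔB _ _ _ _ _).symm
    | add u v hu hv => simp only [map_add, LinearMap.add_apply, hu, hv]
  rw [key, hu]
  refine Eq.trans ?_ ((𝒜.canon_ΔB (ract (π d') a) (ract (π e) c) (lact (π d) m) g b).trans ?_)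
  · rw [← hπ.ΔB_pushB, ← 𝒟.lamT_spec]
  · rw [lact_mul']

theorem sends_compAntipode (hπ : IsMorphism 𝒟 𝒜 π) (a : A) (d d' : D) :
    Bal.Sends (𝒜.comulMap (homR π a) (compAntipode 𝒟 π)) (𝒟.lamT d' d)
      ((𝒜.tc.compr₂ (𝒜.ΔC (ract (π d') a))) ∘ₗ lact (π d)) := by
  intro u hu
  set G := TensorProduct.lift (𝒜.comulMap (homR π a) (compAntipode 𝒟 π)) with hG
  refine LinearMap.ext_on hπ.nondegenerate.left ?_
  rintro _ ⟨f, g, rfl⟩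
  refine LinearMap.ext_on hπ.nondegenerate.left ?_
  rintro _ ⟨h, b, rfl⟩
  -- With `g` and `b` replaced by `π(f) g` and `π(h) b`, everything is pushed forward from `D`,
  -- where `canon_lamT` applies.
  have key : G u (lact (π f) g) (lact (π h) b) =
      𝒜.ΔC a (hπ.pushC g b (𝒟.canon ((balRel _ _).mkQ u) f h)) := by
    clear hu
    induction u using TensorProduct.induction_on with
    | zero => simp
    | tmul p q =>
      refine Eq.trans ?_ (hπ.ΔC_pushC a g b p f (𝒟.S q * h)).symm
      rw [map_mul π (𝒟.S q) h]
      rfl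
    | add u v hu hv => simp only [map_add, LinearMap.add_apply, hu, hv]
  -- In `D` the canonical map gives `Δ_F(d')(d f ⊗ h)`, which is pushed back to `A`.
  rw [key, hu, 𝒟.canon_lamT, hπ.ΔC_pushC, map_mul]
  rfl

theorem comulMap_eq (hπ : IsMorphism 𝒟 𝒜 π) (a : A) :
    𝒜.comulMap (homR π a) (antipodeComp 𝒜 π) = 𝒜.comulMap (homR π a) (compAntipode 𝒟 π) :=
  𝒟.eq_of_sends_lamT (fun d' d => hπ.sends_antipodeComp a d d')
    (fun d' d => hπ.sends_compAntipode a d d')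

end IsMorphism

end Antipode

end MultHopf

end

theorem mainTheorem8 {D : Type*} [NonUnitalRing D] [Module ℂ D] [IsScalarTower ℂ D D]
    [SMulCommClass ℂ D D] {A : Type*} [NonUnitalRing A] [Module ℂ A] [IsScalarTower ℂ A A]
    [SMulCommClass ℂ A A] (𝒟 : MultHopf.RegularMultiplierHopfAlgebroid D)
    (𝒜 : MultHopf.RegularMultiplierHopfAlgebroid A) (π : D →ₙₐ[ℂ] MultHopf.Multiplier A)
    (hπ : MultHopf.IsMorphism 𝒟 𝒜 π) (d : D) :
    π (𝒟.S d) = MultHopf.antiExtend 𝒜.S 𝒜.S_mul (π d) := by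
  refine 𝒜.nondegenerate.multiplier_ext fun b => sub_eq_zero.1 ?_
  refine 𝒜.eq_zero_of_ΔC_eq_zero fun a g => ?_
  let τ : A →ₗ[ℂ] 𝒜.TC :=
    { toFun := fun a => 𝒜.ΔC a (𝒜.tc g (MultHopf.lact (π (𝒟.S d)) b -
        MultHopf.lact (MultHopf.antiExtend 𝒜.S 𝒜.S_mul (π d)) b))
      map_add' := by simp
      map_smul' := by simp }
  -- By `A π(D) = A` it suffices to treat `a π(p)`, where `comulMap_eq` at `p ⊗ d` applies.
  refine LinearMap.congr_fun (LinearMap.ext_on (f := τ) (g := 0) hπ.nondegenerate.right ?_) a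
  rintro _ ⟨p, a, rfl⟩
  have h := congrArg (fun F => F p d g b) (hπ.comulMap_eq a)
  refine (map_sub (𝒜.ΔC _ ∘ₗ 𝒜.tc g) _ _).trans (sub_eq_zero.2 h.symm)
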